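/- Let $\mathbb{R}^{4,2}$ be $\mathbb{R}^6$ with the metric $\langle\cdot,\cdot\rangle$ of signature $(4,2)$. An oriented sphere is a one-dimensional isotropic subspace, a contact element is a two-dimensional totally isotropic subspace, and a $(2,1)$-plane is a three-dimensional subspace on which the metric has signature $(2,1)$. Let $U\subset\mathbb{R}^2$ be open and connected, with coordinates $(u,v)$. A Legendre map $f$ on $U$ is a smooth immersed two-parameter family of contact elements $f(p)$, $p \in U$, such that $\langle s, dt\rangle=0$ for all smooth local sections $s,t$ of $f$. Immersed means that for every $p\in U$ and every direction $X\neq0$ some section $s$ of $f$ near $p$ has $\partial_X s(p)\notin f(p)$. A sphere $\langle x\rangle\subset f(p)$ is a curvature sphere of $f$ at $p$, with curvature direction $X\neq0$, if sections $s$ of $f$ with $s(p)=x$ satisfy $\partial_X s(p)\in f(p)$. The map $f$ is umbilic-free if at no point a single sphere is a curvature sphere for all directions. An umbilic-free Legendre map $f$ is (a piece of) a Dupin cyclide if there is an orthogonal splitting $\mathbb{R}^{4,2}=D_1\oplus_\perp D_2$ into $(2,1)$-planes such that one of its two curvature sphere congruences takes values in $D_1$ and the other one in $D_2$. Two Legendre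 maps $f,\hat f$ on $U$ form a Ribaucour pair if $r(p):=f(p)\cap\hat f(p)$ is one-dimensional for every $p\in U$ and $f$ and $\hat f$ have the same curvature directions at every point; $r$ is their Ribaucour sphere congruence. Let $f,\hat f$ be a Ribaucour pair of umbilic-free Legendre maps on $U$ such that $(u,v)$ are curvature line coordinates (that is, $\partial_u$ and $\partial_v$ are curvature directions at every point), and assume that $r(p)$ is at no point $p$ a curvature sphere of $f$. Then, with $\mathfrak r$ a smooth nowhere vanishing local lift of $r$, the spaces $$C_1=\langle \mathfrak r,\partial_v\mathfrak r,\partial_{vv}\mathfrak r\rangle,\qquad C_2=\langle \mathfrak r,\partial_u\mathfrak r,\partial_{uu}\mathfrak r\rangle$$ are $(2,1)$-planes at every point of $U$; the Dupin cyclides $C_i\oplus_\perp C_i^\perp$ given by them are called the Ribaucour cyclides of the pair. Moreover, $f$ and $\hat f$ are both Dupin cyclides if and only if the Ribaucour cyclides are constant along the corresponding curvature directions, that is, $C_1$ is constant along every segment of a $v$-coordinate line contained in $U$ and $C_2$ is constant along every segment of a $u$-coordinate line contained in $U$. -/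

import Mathlib

open scoped ContDiff

noncomputable section

/-- The vector space `ℝ^{4,2}`. -/
abbrev LieSpace : Type := Fin 6 → ℝ

/-- The metric of signature `(4,2)` on `LieSpace`. -/
def lieForm : LinearMap.BilinForm ℝ LieSpace :=
  Matrix.toBilin' (Matrix.diagonal ![1, 1, 1, 1, -1, -1])

/-- `W` is a `(2,1)`-plane: a three-dimensional subspace on which the metric has
signature `(2,1)`, that is, one with a pseudo-orthonormal basis of this signature. -/
def IsPlane21 (W : Submodule ℝ LieSpace) : Prop :=
  ∃ e : Fin 3 → LieSpace, Submodule.span ℝ (Set.range e) = W ∧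
    (∀ i, lieForm (e i) (e i) = (![1, 1, -1] : Fin 3 → ℝ) i) ∧
    ∀ i j, i ≠ j → lieForm (e i) (e j) = 0

/-- A contact element: a two-dimensional totally isotropic subspace, i.e. a projective line
in the Lie quadric. -/
def IsContactElement (W : Submodule ℝ LieSpace) : Prop :=
  Module.finrank ℝ W = 2 ∧ ∀ x ∈ W, ∀ y ∈ W, lieForm x y = 0

/-- `s` is a smooth section over the open set `N` of the family `E` of subspaces. -/
structure IsSectionOn (E : ℝ × ℝ → Submodule ℝ LieSpace) (N : Set (ℝ × ℝ))
    (s : ℝ × ℝ → LieSpace) : Prop where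
  isOpen : IsOpen N
  smooth : ContDiffOn ℝ ∞ s N
  mem : ∀ q ∈ N, s q ∈ E q

/-- The derivative of `s` in the constant direction `X`, as a function of the base point. -/
def dirDeriv (X : ℝ × ℝ) (s : ℝ × ℝ → LieSpace) : ℝ × ℝ → LieSpace :=
  fun q => fderiv ℝ s q X

/-- The coordinate direction `∂_u`. -/
abbrev dirU : ℝ × ℝ := (1, 0)

/-- The coordinate direction `∂_v`. -/
abbrev dirV : ℝ × ℝ := (0, 1)

/-- A Legendre map on the open set `U` of the `(u,v)`-plane: a smooth immersed two-parameter
family of contact elements satisfying the contact condition. -/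
structure IsLegendreMap (f : ℝ × ℝ → Submodule ℝ LieSpace) (U : Set (ℝ × ℝ)) : Prop where
  contactElement : ∀ p ∈ U, IsContactElement (f p)
  smooth : ∀ p ∈ U, ∃ N, p ∈ N ∧ ∃ s t : ℝ × ℝ → LieSpace,
    IsSectionOn f N s ∧ IsSectionOn f N t ∧ ∀ q ∈ N, f q = Submodule.span ℝ {s q, t q}
  contact : ∀ p ∈ U, ∀ N, p ∈ N → ∀ s t : ℝ × ℝ → LieSpace,
    IsSectionOn f N s → IsSectionOn f N t → ∀ X, lieForm (s p) (dirDeriv X t p) = 0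
  immersion : ∀ p ∈ U, ∀ X : ℝ × ℝ, X ≠ 0 →
    ∃ N, p ∈ N ∧ ∃ s, IsSectionOn f N s ∧ dirDeriv X s p ∉ f p

/-- The vector `x` represents a curvature sphere of `f` at `p` for the direction `X`:
it is nonzero, and a section of `f` through `x` has its derivative along `X` in `f p`
(for a Legendre map this does not depend on the section). -/
def IsCurvatureSphere (f : ℝ × ℝ → Submodule ℝ LieSpace) (p X : ℝ × ℝ) (x : LieSpace) : Prop :=
  x ≠ 0 ∧ ∃ N, p ∈ N ∧ ∃ s, IsSectionOn f N s ∧ s p = x ∧ dirDeriv X s p ∈ f p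

/-- `X` is a curvature direction of `f` at `p`. -/
def IsCurvatureDirection (f : ℝ × ℝ → Submodule ℝ LieSpace) (p X : ℝ × ℝ) : Prop :=
  X ≠ 0 ∧ ∃ x, IsCurvatureSphere f p X x

/-- `f` has no umbilics on `U`: at no point is a single sphere a curvature sphere for
all directions. -/
def IsUmbilicFree (f : ℝ × ℝ → Submodule ℝ LieSpace) (U : Set (ℝ × ℝ)) : Prop :=
  ∀ p ∈ U, ¬ ∃ x, ∀ X, X ≠ 0 → IsCurvatureSphere f p X x

/-- The coordinates `(u,v)` are curvature line coordinates of `f` on `U`. -/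
def IsCurvatureLineParametrized (f : ℝ × ℝ → Submodule ℝ LieSpace) (U : Set (ℝ × ℝ)) : Prop :=
  ∀ p ∈ U, IsCurvatureDirection f p dirU ∧ IsCurvatureDirection f p dirV

/-- `f` and `g` form a Ribaucour pair: they envelop a common sphere congruence, given by the
intersection of their contact elements, and their curvature directions correspond. -/
structure IsRibaucourPair (f g : ℝ × ℝ → Submodule ℝ LieSpace) (U : Set (ℝ × ℝ)) : Prop where
  left : IsLegendreMap f U
  right : IsLegendreMap g U
  envelop : ∀ p ∈ U, Module.finrank ℝ (f p ⊓ g p : Submodule ℝ LieSpace) = 1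
  curvature : ∀ p ∈ U, ∀ X, IsCurvatureDirection f p X ↔ IsCurvatureDirection g p X

/-- The Ribaucour sphere congruence `r = f ∩ g`. -/
def ribaucourSphere (f g : ℝ × ℝ → Submodule ℝ LieSpace) : ℝ × ℝ → Submodule ℝ LieSpace :=
  fun p => f p ⊓ g p

/-- `f` is (a piece of) a Dupin cyclide: there is an orthogonal splitting of `ℝ^{4,2}` into two
`(2,1)`-planes `D₁`, `D₂` such that one curvature sphere congruence of `f` takes values in `D₁`
and the other one in `D₂`. -/
def IsDupinCyclide (f : ℝ × ℝ → Submodule ℝ LieSpace) (U : Set (ℝ × ℝ)) : Prop :=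
  ∃ D₁ D₂ : Submodule ℝ LieSpace, IsPlane21 D₁ ∧ IsPlane21 D₂ ∧
    (∀ x ∈ D₁, ∀ y ∈ D₂, lieForm x y = 0) ∧
    ∀ p ∈ U, (∃ x ∈ D₁, ∃ X, X ≠ 0 ∧ IsCurvatureSphere f p X x) ∧
      (∃ y ∈ D₂, ∃ Y, Y ≠ 0 ∧ IsCurvatureSphere f p Y y)

/-- The space `⟨r, ∂_X r, ∂_X ∂_X r⟩` at `p`, taken over all smooth nowhere vanishing local
lifts of the sphere congruence `r`; by `osculatingSpace_eq` a single lift gives the same space. -/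
def osculatingSpace (r : ℝ × ℝ → Submodule ℝ LieSpace) (X p : ℝ × ℝ) : Submodule ℝ LieSpace :=
  Submodule.span ℝ {w | ∃ N, p ∈ N ∧ ∃ s, IsSectionOn r N s ∧ (∀ q ∈ N, s q ≠ 0) ∧
    (w = s p ∨ w = dirDeriv X s p ∨ w = dirDeriv X (dirDeriv X s) p)}

theorem osculatingSpace_eq {r : ℝ × ℝ → Submodule ℝ LieSpace} {N : Set (ℝ × ℝ)}
    (hr : ∀ q ∈ N, Module.finrank ℝ (r q) = 1) {s : ℝ × ℝ → LieSpace}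
    (hs : IsSectionOn r N s) (hs0 : ∀ q ∈ N, s q ≠ 0) (X : ℝ × ℝ) {p : ℝ × ℝ} (hp : p ∈ N) :
    osculatingSpace r X p =
      Submodule.span ℝ {s p, dirDeriv X s p, dirDeriv X (dirDeriv X s) p} := by
  apply le_antisymm
  · refine Submodule.span_le.2 ?_
    rintro w ⟨N', hp', t, ht, ht0, hw⟩
    obtain ⟨i, hi⟩ : ∃ i, s p i ≠ 0 := by
      by_contra! h
      exact hs0 p hp (funext h)
    set c : ℝ × ℝ → ℝ := fun q => t q i / s q i with hc
    have hsp : ContDiffAt ℝ 2 s p :=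
      (hs.smooth.contDiffAt (hs.isOpen.mem_nhds hp)).of_le (WithTop.coe_le_coe.2 le_top)
    have htp : ContDiffAt ℝ 2 t p :=
      (ht.smooth.contDiffAt (ht.isOpen.mem_nhds hp')).of_le (WithTop.coe_le_coe.2 le_top)
    have hcp : ContDiffAt ℝ 2 c p :=
      ((contDiffAt_pi.1 htp) i).div ((contDiffAt_pi.1 hsp) i) hi
    have hne : ∀ᶠ q in nhds p, s q i ≠ 0 :=
      (((contDiffAt_pi.1 hsp) i).continuousAt).eventually_ne hi
    have hts : t =ᶠ[nhds p] fun q => c q • s q := by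
      filter_upwards [hne, hs.isOpen.mem_nhds hp, ht.isOpen.mem_nhds hp'] with q hq hqN hqN'
      obtain ⟨a, ha⟩ := (finrank_eq_one_iff_of_nonzero' (⟨s q, hs.mem q hqN⟩ : r q)
        (by simpa using hs0 q hqN)).1 (hr q hqN) ⟨t q, ht.mem q hqN'⟩
      have ha' : a • s q = t q := congrArg Subtype.val ha
      have : c q = a := by
        simp only [hc, ← ha', Pi.smul_apply, smul_eq_mul]
        field_simp
      rw [this, ha']
    have hd1 : dirDeriv X t =ᶠ[nhds p]
        fun q => c q • dirDeriv X s q + (fderiv ℝ c q X) • s q := by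
      have e1 := (hcp.eventually (by simp)).and (hsp.eventually (by simp))
      filter_upwards [hts.eventuallyEq_nhds, e1] with q hq hq'
      have h1 : DifferentiableAt ℝ c q := hq'.1.differentiableAt (by norm_num)
      have h2 : DifferentiableAt ℝ s q := hq'.2.differentiableAt (by norm_num)
      simp only [dirDeriv]
      rw [hq.fderiv_eq, fderiv_fun_smul h1 h2]
      simp
    have hc1 : DifferentiableAt ℝ c p := hcp.differentiableAt (by norm_num)
    have hs1 : DifferentiableAt ℝ s p := hsp.differentiableAt (by norm_num)
    have hc2 : DifferentiableAt ℝ (fun q => fderiv ℝ c q X) p :=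
      ((hcp.fderiv_right (m := 1) (by norm_num)).differentiableAt (by norm_num)).clm_apply
        (differentiableAt_const X)
    have hs2 : DifferentiableAt ℝ (dirDeriv X s) p :=
      ((hsp.fderiv_right (m := 1) (by norm_num)).differentiableAt (by norm_num)).clm_apply
        (differentiableAt_const X)
    have hd2 : dirDeriv X (dirDeriv X t) p = c p • dirDeriv X (dirDeriv X s) p +
        (fderiv ℝ c p X) • dirDeriv X s p + ((fderiv ℝ c p X) • dirDeriv X s p +
        (fderiv ℝ (fun q => fderiv ℝ c q X) p X) • s p) := by
      conv_lhs => unfold dirDeriv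
      change fderiv ℝ (dirDeriv X t) p X = _
      rw [hd1.fderiv_eq, fderiv_fun_add (hc1.fun_smul hs2) (hc2.fun_smul hs1),
        fderiv_fun_smul hc1 hs2, fderiv_fun_smul hc2 hs1]
      simp [dirDeriv]
    have m0 : s p ∈ Submodule.span ℝ {s p, dirDeriv X s p, dirDeriv X (dirDeriv X s) p} :=
      Submodule.subset_span (by simp)
    have m1 : dirDeriv X s p ∈
        Submodule.span ℝ {s p, dirDeriv X s p, dirDeriv X (dirDeriv X s) p} :=
      Submodule.subset_span (by simp)
    have m2 : dirDeriv X (dirDeriv X s) p ∈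
        Submodule.span ℝ {s p, dirDeriv X s p, dirDeriv X (dirDeriv X s) p} :=
      Submodule.subset_span (by simp)
    rcases hw with rfl | rfl | rfl
    · rw [hts.eq_of_nhds]
      exact Submodule.smul_mem _ _ m0
    · rw [hd1.eq_of_nhds]
      exact add_mem (Submodule.smul_mem _ _ m1) (Submodule.smul_mem _ _ m0)
    · rw [hd2]
      exact add_mem (add_mem (Submodule.smul_mem _ _ m2) (Submodule.smul_mem _ _ m1))
        (add_mem (Submodule.smul_mem _ _ m1) (Submodule.smul_mem _ _ m0))
  · refine Submodule.span_mono ?_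
    intro w hw
    exact ⟨N, hp, s, hs, hs0, by simpa using hw⟩

/-- The first Ribaucour cyclide `C₁ = ⟨r, ∂_v r, ∂_v ∂_v r⟩` of the pair `f`, `g` at `p`; it
stands for the Dupin cyclide with the splitting `C₁ ⊕ C₁^⊥`. -/
def ribaucourCyclide₁ (f g : ℝ × ℝ → Submodule ℝ LieSpace) (p : ℝ × ℝ) : Submodule ℝ LieSpace :=
  osculatingSpace (ribaucourSphere f g) dirV p

/-- The second Ribaucour cyclide `C₂ = ⟨r, ∂_u r, ∂_u ∂_u r⟩` of the pair `f`, `g` at `p`; it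
stands for the Dupin cyclide with the splitting `C₂ ⊕ C₂^⊥`. -/
def ribaucourCyclide₂ (f g : ℝ × ℝ → Submodule ℝ LieSpace) (p : ℝ × ℝ) : Submodule ℝ LieSpace :=
  osculatingSpace (ribaucourSphere f g) dirU p

/-- `C` is constant along the `u`-coordinate lines in `U`. -/
def IsConstantAlongU (C : ℝ × ℝ → Submodule ℝ LieSpace) (U : Set (ℝ × ℝ)) : Prop :=
  ∀ u u' v : ℝ, (∀ t ∈ Set.uIcc u u', (t, v) ∈ U) → C (u, v) = C (u', v)

/-- `C` is constant along the `v`-coordinate lines in `U`. -/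
def IsConstantAlongV (C : ℝ × ℝ → Submodule ℝ LieSpace) (U : Set (ℝ × ℝ)) : Prop :=
  ∀ u v v' : ℝ, (∀ t ∈ Set.uIcc v v', (u, t) ∈ U) → C (u, v) = C (u, v')

end

open Filter Topology

/-! The form is positive definite on `W^⊥/W` for a contact element `W`. For a lift `r` of the
Ribaucour congruence, `r_X` is orthogonal to `f` and not in `f`, so `⟨r_X, r_X⟩ > 0`; with `⟨r,
r_XX⟩ = -⟨r_X, r_X⟩` this determines the signature of the osculating plane (`isPlane21_osculating`).

Dupin implies constant. Let `X` be a coordinate direction and let `D ⊕ D'` split `f`, with the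
curvature spheres for `X` in `D`. The line `f ⊓ D` is constant along `X`, since the derivative of a
section of it lies again in `f` and in `D`. Hence `r` moves along `X` inside the fixed four-space `f
⊓ D ⊔ D'`, which therefore contains the osculating plane. The same holds for `g` with a splitting `E
⊕ E'`. The two four-spaces differ: otherwise their radicals `f ⊓ D` and `g ⊓ E` would agree, making
`r` a curvature sphere. So the osculating plane is their intersection, which is constant along `X`
(`locallyConstantAlong_osculatingSpace`). Connectedness of `U` is needed to attach the planes of a
splitting to fixed directions (`exists_splitting`).

Constant implies Dupin. The curvature sphere `s` of `f` for `X` is orthogonal to the osculating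
plane `C` of `r` along `X`. If `C` is constant along `X`, then `s_X` is orthogonal to `C` too; being
a combination of `s` and `r`, it is a multiple of `s`, because `C` is nondegenerate. So curvature
spheres are constant along their own curvature lines. On a coordinate square all spheres of one
family are then orthogonal to all of the other, and their osculating planes along the opposite
direction give the splitting (`isDupinCyclide`). The argument applies to `f` and `g` separately. -/

/-! ### Linear algebra of contact elements and `(2,1)`-planes -/

theorem lieForm_apply (x y : LieSpace) :
    lieForm x y = x 0 * y 0 + x 1 * y 1 + x 2 * y 2 + x 3 * y 3 - x 4 * y 4 - x 5 * y 5 := by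
  rw [lieForm, Matrix.toBilin'_apply']
  simp [dotProduct, Fin.sum_univ_six, Matrix.mulVec_diagonal]
  ring

theorem lieForm_comm (x y : LieSpace) : lieForm x y = lieForm y x := by
  simp only [lieForm_apply]
  ring

/-- A vector orthogonal to a contact element and of nonpositive norm lies in it. -/
theorem IsContactElement.mem_of_orth {W : Submodule ℝ LieSpace} (hW : IsContactElement W)
    {x : LieSpace} (hx : ∀ y ∈ W, lieForm x y = 0) (h : lieForm x x ≤ 0) : x ∈ W := by
  by_contra hxW
  let b := Module.finBasisOfFinrankEq ℝ W hW.1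
  let L : (Fin 3 → ℝ) →ₗ[ℝ] LieSpace :=
    Fintype.linearCombination ℝ ![(b 0 : LieSpace), (b 1 : LieSpace), x]
  let P : LieSpace →ₗ[ℝ] (Fin 2 → ℝ) := LinearMap.pi ![LinearMap.proj 4, LinearMap.proj 5]
  -- Three coefficients against two negative coordinates: some nontrivial combination has vanishing
  -- last two coordinates. Its norm is a sum of squares, yet nonpositive by assumption, so the
  -- combination is zero.
  obtain ⟨c, hc, hc0⟩ : ∃ c ∈ LinearMap.ker (P ∘ₗ L), c ≠ 0 :=
    Submodule.exists_mem_ne_zero_of_ne_bot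
      (LinearMap.ker_ne_bot_of_finrank_lt (by simp))
  set w : LieSpace := c 0 • (b 0 : LieSpace) + c 1 • (b 1 : LieSpace) with hw
  have hwW : w ∈ W := add_mem (W.smul_mem _ (b 0).2) (W.smul_mem _ (b 1).2)
  have hL : L c = w + c 2 • x := by
    simp [L, Fintype.linearCombination_apply, Fin.sum_univ_three, hw]
  have h4 : L c 4 = 0 := congrFun (LinearMap.mem_ker.1 hc) 0
  have h5 : L c 5 = 0 := congrFun (LinearMap.mem_ker.1 hc) 1
  have hn : lieForm (L c) (L c) = c 2 ^ 2 * lieForm x x := by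
    rw [hL]
    simp [hW.2 w hwW w hwW, hx w hwW, lieForm_comm w x]
    ring
  have hn' : lieForm (L c) (L c) ≤ 0 := by
    rw [hn]
    exact mul_nonpos_of_nonneg_of_nonpos (sq_nonneg _) h
  rw [lieForm_apply, h4, h5] at hn'
  have hz : L c = 0 := by
    have p0 := mul_self_nonneg (L c 0)
    have p1 := mul_self_nonneg (L c 1)
    have p2 := mul_self_nonneg (L c 2)
    have p3 := mul_self_nonneg (L c 3)
    ext i
    fin_cases i
    · exact mul_self_eq_zero.1 (by linarith : L c 0 * L c 0 = 0)
    · exact mul_self_eq_zero.1 (by linarith : L c 1 * L c 1 = 0)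
    · exact mul_self_eq_zero.1 (by linarith : L c 2 * L c 2 = 0)
    · exact mul_self_eq_zero.1 (by linarith : L c 3 * L c 3 = 0)
    · exact h4
    · exact h5
  have hc2 : c 2 = 0 := by
    by_contra h2
    refine hxW ?_
    have : x = (-(c 2)⁻¹) • w := by
      have : c 2 • x = -w := by
        rw [hL] at hz
        exact eq_neg_of_add_eq_zero_right hz
      rw [neg_smul, ← smul_neg, ← this, smul_smul, inv_mul_cancel₀ h2, one_smul]
    rw [this]
    exact W.smul_mem _ hwW
  have hb : c 0 • b 0 + c 1 • b 1 = 0 := by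
    apply Subtype.ext
    simpa [hL, hc2, hw] using hz
  have hli := Fintype.linearIndependent_iff.1 b.linearIndependent ![c 0, c 1]
    (by simpa [Fin.sum_univ_two] using hb)
  refine hc0 (funext fun i => ?_)
  fin_cases i
  · exact hli 0
  · exact hli 1
  · exact hc2

theorem IsContactElement.pos_of_orth {W : Submodule ℝ LieSpace} (hW : IsContactElement W)
    {x : LieSpace} (hx : ∀ y ∈ W, lieForm x y = 0) (h : x ∉ W) : 0 < lieForm x x := by
  by_contra! h'
  exact h (hW.mem_of_orth hx h')

theorem IsPlane21.eq_zero_of_orth {W : Submodule ℝ LieSpace} (hW : IsPlane21 W) {x : LieSpace}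
    (hx : x ∈ W) (h : ∀ y ∈ W, lieForm x y = 0) : x = 0 := by
  obtain ⟨e, rfl, hn, ho⟩ := hW
  obtain ⟨c, rfl⟩ := (Submodule.mem_span_range_iff_exists_fun ℝ).1 hx
  refine Finset.sum_eq_zero fun i _ => ?_
  have hi := h (e i) (Submodule.subset_span ⟨i, rfl⟩)
  rw [map_sum, LinearMap.sum_apply, Finset.sum_eq_single i] at hi
  · have : lieForm (e i) (e i) ≠ 0 := by
      rw [hn]
      fin_cases i <;> simp
    simp only [map_smul, LinearMap.smul_apply, smul_eq_mul, mul_eq_zero, this, or_false] at hi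
    rw [hi, zero_smul]
  · intro j _ hj
    simp [ho j i hj]
  · simp

theorem IsPlane21.finrank_eq {W : Submodule ℝ LieSpace} (hW : IsPlane21 W) :
    Module.finrank ℝ W = 3 := by
  obtain ⟨e, rfl, hn, ho⟩ := hW
  rw [finrank_span_eq_card, Fintype.card_fin]
  refine Fintype.linearIndependent_iff.2 fun c hc i => ?_
  have hi : lieForm (∑ j, c j • e j) (e i) = 0 := by rw [hc]; simp
  rw [map_sum, LinearMap.sum_apply, Finset.sum_eq_single i] at hi
  · have : lieForm (e i) (e i) ≠ 0 := by
      rw [hn]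
      fin_cases i <;> simp
    simpa [this] using hi
  · intro j _ hj
    simp [ho j i hj]
  · simp

/-- Two orthogonal `(2,1)`-planes are complementary. -/
theorem IsPlane21.isCompl {W W' : Submodule ℝ LieSpace} (hW : IsPlane21 W) (hW' : IsPlane21 W')
    (h : ∀ x ∈ W, ∀ y ∈ W', lieForm x y = 0) : IsCompl W W' := by
  have hd : Disjoint W W' := Submodule.disjoint_def.2 fun x hx hx' =>
    hW.eq_zero_of_orth hx fun y hy => by rw [lieForm_comm]; exact h y hy x hx'
  refine ⟨hd, codisjoint_iff.2 (Submodule.eq_top_of_finrank_eq ?_)⟩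
  have := Submodule.finrank_sup_add_finrank_inf_eq W W'
  rw [hd.eq_bot, finrank_bot, hW.finrank_eq, hW'.finrank_eq] at this
  rw [Module.finrank_fin_fun]
  omega

/-- Each of two orthogonal `(2,1)`-planes is the orthogonal complement of the other. -/
theorem IsPlane21.mem_of_orth {W W' : Submodule ℝ LieSpace} (hW : IsPlane21 W)
    (hW' : IsPlane21 W') (h : ∀ x ∈ W, ∀ y ∈ W', lieForm x y = 0) {z : LieSpace}
    (hz : ∀ y ∈ W', lieForm z y = 0) : z ∈ W := by
  obtain ⟨a, ha, b, hb, rfl⟩ := Submodule.mem_sup.1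
    ((hW.isCompl hW' h).sup_eq_top ▸ Submodule.mem_top : z ∈ W ⊔ W')
  have : b = 0 := hW'.eq_zero_of_orth hb fun y hy => by simpa [h a ha y hy] using hz y hy
  simpa [this] using ha

/-- These are the products of an osculating frame `s, s_X, s_XX`. The span is the positive line of
`b` plus a hyperbolic plane orthogonal to it. -/
theorem isPlane21_span_of_gram {a b c : LieSpace} (haa : lieForm a a = 0) (hab : lieForm a b = 0)
    (hbb : 0 < lieForm b b) (hac : lieForm a c = -lieForm b b) :
    IsPlane21 (Submodule.span ℝ {a, b, c}) := by
  set k := lieForm b b with hk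
  set m := lieForm b c with hm
  set n := lieForm c c with hn
  set σ := √k with hσ
  set τ := √(2 * k) with hτ
  have hσ2 : σ * σ = k := Real.mul_self_sqrt hbb.le
  have hτ2 : τ * τ = 2 * k := Real.mul_self_sqrt (by positivity)
  have hσ0 : σ ≠ 0 := (Real.sqrt_pos.2 hbb).ne'
  have hτ0 : τ ≠ 0 := (Real.sqrt_pos.2 (by positivity)).ne'
  have hk0 : k ≠ 0 := hbb.ne'
  have hba : lieForm b a = 0 := by rw [lieForm_comm, hab]
  have hca : lieForm c a = -k := by rw [lieForm_comm, hac]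
  have hcb : lieForm c b = m := by rw [lieForm_comm]
  -- the projection of `c` to the orthogonal complement of `b`, made isotropic
  set l := (n - m ^ 2 / k) / (2 * k) with hl
  set w : LieSpace := c - (m / k) • b + l • a with hw
  have hwa : lieForm w a = -k := by simp [hw, hca, hba, haa]
  have hwb : lieForm w b = 0 := by simp [hw, hcb, ← hk, hab]; field_simp; ring
  have hww : lieForm w w = 0 := by
    simp [hw, hca, hba, haa, hcb, ← hk, ← hm, ← hn, hab, hac, hl]
    field_simp
    ring
  have haw : lieForm a w = -k := by rw [lieForm_comm, hwa]
  have hbw : lieForm b w = 0 := by rw [lieForm_comm, hwb]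
  -- As `a` and `w` are isotropic with product `-k`, the vectors `w - a` and `w + a` are orthogonal
  -- with norms `2k` and `-2k`.
  refine ⟨![τ⁻¹ • (w - a), σ⁻¹ • b, τ⁻¹ • (w + a)], ?_, ?_, ?_⟩
  · apply le_antisymm
    · rw [Submodule.span_le]
      have ha : a ∈ Submodule.span ℝ {a, b, c} := Submodule.subset_span (by simp)
      have hb : b ∈ Submodule.span ℝ {a, b, c} := Submodule.subset_span (by simp)
      have hc : c ∈ Submodule.span ℝ {a, b, c} := Submodule.subset_span (by simp)
      have hw' : w ∈ Submodule.span ℝ {a, b, c} :=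
        add_mem (sub_mem hc (Submodule.smul_mem _ _ hb)) (Submodule.smul_mem _ _ ha)
      rintro _ ⟨i, rfl⟩
      fin_cases i
      · exact Submodule.smul_mem _ _ (sub_mem hw' ha)
      · exact Submodule.smul_mem _ _ hb
      · exact Submodule.smul_mem _ _ (add_mem hw' ha)
    · set S := Submodule.span ℝ (Set.range ![τ⁻¹ • (w - a), σ⁻¹ • b, τ⁻¹ • (w + a)])
      have h0 : τ⁻¹ • (w - a) ∈ S := Submodule.subset_span ⟨0, rfl⟩
      have h1 : σ⁻¹ • b ∈ S := Submodule.subset_span ⟨1, rfl⟩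
      have h2 : τ⁻¹ • (w + a) ∈ S := Submodule.subset_span ⟨2, rfl⟩
      have h0' : w - a ∈ S := by simpa [smul_smul, hτ0] using S.smul_mem τ h0
      have h2' : w + a ∈ S := by simpa [smul_smul, hτ0] using S.smul_mem τ h2
      have hb : b ∈ S := by simpa [smul_smul, hσ0] using S.smul_mem σ h1
      have ha : a ∈ S := by
        have : a = (2⁻¹ : ℝ) • ((w + a) - (w - a)) := by module
        rw [this]
        exact S.smul_mem _ (sub_mem h2' h0')
      have hw' : w ∈ S := by simpa using add_mem h0' ha
      have hc : c ∈ S := by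
        have : c = w + (m / k) • b - l • a := by rw [hw]; module
        rw [this]
        exact sub_mem (add_mem hw' (S.smul_mem _ hb)) (S.smul_mem _ ha)
      rw [Submodule.span_le]
      rintro x (rfl | rfl | rfl) <;> assumption
  · intro i
    fin_cases i
    · simp [hww, hwa, haw, haa]; field_simp; linarith
    · simp [← hk]; field_simp; linarith
    · simp [hww, hwa, haw, haa]; field_simp; linarith
  · intro i j hij
    fin_cases i <;> fin_cases j <;>
      simp [hww, hwa, haw, haa, hwb, hbw, hab, hba] at hij ⊢

/-! ### Calculus of sections -/

theorem IsSectionOn.contDiffAt {E : ℝ × ℝ → Submodule ℝ LieSpace} {N : Set (ℝ × ℝ)}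
    {s : ℝ × ℝ → LieSpace} (hs : IsSectionOn E N s) {q : ℝ × ℝ} (hq : q ∈ N) :
    ContDiffAt ℝ ∞ s q := hs.smooth.contDiffAt (hs.isOpen.mem_nhds hq)

theorem IsSectionOn.differentiableAt {E : ℝ × ℝ → Submodule ℝ LieSpace} {N : Set (ℝ × ℝ)}
    {s : ℝ × ℝ → LieSpace} (hs : IsSectionOn E N s) {q : ℝ × ℝ} (hq : q ∈ N) :
    DifferentiableAt ℝ s q := (hs.contDiffAt hq).differentiableAt (by simp)

theorem contDiffOn_dirDeriv {N : Set (ℝ × ℝ)} (hN : IsOpen N) {s : ℝ × ℝ → LieSpace}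
    (hs : ContDiffOn ℝ ∞ s N) (X : ℝ × ℝ) : ContDiffOn ℝ ∞ (dirDeriv X s) N :=
  (hs.fderiv_of_isOpen hN (by simp)).clm_apply contDiffOn_const

theorem IsSectionOn.differentiableAt_dirDeriv {E : ℝ × ℝ → Submodule ℝ LieSpace}
    {N : Set (ℝ × ℝ)} {s : ℝ × ℝ → LieSpace} (hs : IsSectionOn E N s) (X : ℝ × ℝ)
    {q : ℝ × ℝ} (hq : q ∈ N) : DifferentiableAt ℝ (dirDeriv X s) q :=
  ((contDiffOn_dirDeriv hs.isOpen hs.smooth X).contDiffAt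
    (hs.isOpen.mem_nhds hq)).differentiableAt (by simp)

theorem IsSectionOn.mono {E E' : ℝ × ℝ → Submodule ℝ LieSpace} {N N' : Set (ℝ × ℝ)}
    {s : ℝ × ℝ → LieSpace} (hs : IsSectionOn E N s) (hN' : IsOpen N') (h : N' ⊆ N)
    (hE : ∀ q ∈ N', s q ∈ E q → s q ∈ E' q) : IsSectionOn E' N' s :=
  ⟨hN', hs.smooth.mono h, fun q hq => hE q hq (hs.mem q (h hq))⟩

theorem IsSectionOn.inter {E : ℝ × ℝ → Submodule ℝ LieSpace} {N N' : Set (ℝ × ℝ)}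
    {s : ℝ × ℝ → LieSpace} (hs : IsSectionOn E N s) (hN' : IsOpen N') :
    IsSectionOn E (N ∩ N') s :=
  hs.mono (hs.isOpen.inter hN') Set.inter_subset_left fun _ _ h => h

theorem IsSectionOn.add {E : ℝ × ℝ → Submodule ℝ LieSpace} {N : Set (ℝ × ℝ)}
    {s t : ℝ × ℝ → LieSpace} (hs : IsSectionOn E N s) (ht : IsSectionOn E N t) :
    IsSectionOn E N (s + t) :=
  ⟨hs.isOpen, hs.smooth.add ht.smooth, fun q hq => add_mem (hs.mem q hq) (ht.mem q hq)⟩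

theorem IsSectionOn.smul {E : ℝ × ℝ → Submodule ℝ LieSpace} {N : Set (ℝ × ℝ)}
    {s : ℝ × ℝ → LieSpace} (hs : IsSectionOn E N s) {c : ℝ × ℝ → ℝ} (hc : ContDiffOn ℝ ∞ c N) :
    IsSectionOn E N (fun q => c q • s q) :=
  ⟨hs.isOpen, hc.smul hs.smooth, fun q hq => (E q).smul_mem _ (hs.mem q hq)⟩

theorem IsSectionOn.const_smul {E : ℝ × ℝ → Submodule ℝ LieSpace} {N : Set (ℝ × ℝ)}
    {s : ℝ × ℝ → LieSpace} (hs : IsSectionOn E N s) (c : ℝ) : IsSectionOn E N (c • s) :=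
  hs.smul contDiffOn_const

theorem dirDeriv_add {X q : ℝ × ℝ} {s t : ℝ × ℝ → LieSpace} (hs : DifferentiableAt ℝ s q)
    (ht : DifferentiableAt ℝ t q) : dirDeriv X (s + t) q = dirDeriv X s q + dirDeriv X t q := by
  simp [dirDeriv, fderiv_add hs ht]

theorem dirDeriv_const_smul {X q : ℝ × ℝ} {s : ℝ × ℝ → LieSpace} (hs : DifferentiableAt ℝ s q)
    (c : ℝ) : dirDeriv X (c • s) q = c • dirDeriv X s q := by
  simp [dirDeriv, fderiv_const_smul hs c]

theorem contDiffOn_lieForm {N : Set (ℝ × ℝ)} {s t : ℝ × ℝ → LieSpace} (hs : ContDiffOn ℝ ∞ s N)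
    (ht : ContDiffOn ℝ ∞ t N) : ContDiffOn ℝ ∞ (fun q => lieForm (s q) (t q)) N :=
  ((LinearMap.toContinuousBilinearMap lieForm).isBoundedBilinearMap.contDiff).comp_contDiffOn
    (hs.prodMk ht)

theorem fderiv_lieForm {q : ℝ × ℝ} {s t : ℝ × ℝ → LieSpace}
    (hs : DifferentiableAt ℝ s q) (ht : DifferentiableAt ℝ t q) (X : ℝ × ℝ) :
    fderiv ℝ (fun q => lieForm (s q) (t q)) q X =
      lieForm (s q) (dirDeriv X t q) + lieForm (dirDeriv X s q) (t q) := by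
  have := (LinearMap.toContinuousBilinearMap lieForm).fderiv_of_bilinear hs ht
  exact DFunLike.congr_fun this X

/-- Leibniz' rule for an identity `⟨s, t⟩ = 0`. -/
theorem lieForm_dirDeriv_add_eq_zero {q : ℝ × ℝ} {s t : ℝ × ℝ → LieSpace}
    (hs : DifferentiableAt ℝ s q) (ht : DifferentiableAt ℝ t q)
    (h : ∀ᶠ q' in 𝓝 q, lieForm (s q') (t q') = 0) (X : ℝ × ℝ) :
    lieForm (s q) (dirDeriv X t q) + lieForm (dirDeriv X s q) (t q) = 0 := by
  rw [← fderiv_lieForm hs ht, EventuallyEq.fderiv_eq (f := fun _ => (0 : ℝ)) h]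
  simp

theorem dirDeriv_comm {q : ℝ × ℝ} {s : ℝ × ℝ → LieSpace} (hs : ContDiffAt ℝ ∞ s q)
    (X Y : ℝ × ℝ) : dirDeriv X (dirDeriv Y s) q = dirDeriv Y (dirDeriv X s) q := by
  have hd : DifferentiableAt ℝ (fderiv ℝ s) q :=
    (hs.fderiv_right (m := ∞) (by simp)).differentiableAt (by simp)
  have key : ∀ X Y, dirDeriv X (dirDeriv Y s) q = fderiv ℝ (fderiv ℝ s) q X Y := by
    intro X Y
    change fderiv ℝ (fun q => fderiv ℝ s q Y) q X = _
    rw [fderiv_clm_apply hd (differentiableAt_const Y)]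
    simp
  rw [key, key]
  exact hs.isSymmSndFDerivAt (by
    rw [minSmoothness_of_isRCLikeNormedField]
    exact WithTop.coe_le_coe.2 le_top) X Y

theorem hasDerivAt_line {X p : ℝ × ℝ} {s : ℝ × ℝ → LieSpace} {t : ℝ}
    (hs : DifferentiableAt ℝ s (p + t • X)) :
    HasDerivAt (fun t : ℝ => s (p + t • X)) (dirDeriv X s (p + t • X)) t := by
  have h : HasDerivAt (fun t : ℝ => p + t • X) X t := by
    simpa using ((hasDerivAt_id t).smul_const X).const_add p
  exact hs.hasFDerivAt.comp_hasDerivAt t h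

theorem tendsto_line (X p : ℝ × ℝ) : Tendsto (fun t : ℝ => p + t • X) (𝓝 0) (𝓝 p) := by
  have : Continuous fun t : ℝ => p + t • X := by fun_prop
  simpa using this.tendsto 0

/-- If `s` stays in a subspace along a line, so does its derivative along the line. -/
theorem dirDeriv_mem {X p : ℝ × ℝ} {s : ℝ × ℝ → LieSpace} (hs : DifferentiableAt ℝ s p)
    {W : Submodule ℝ LieSpace} (h : ∀ᶠ t in 𝓝 (0 : ℝ), s (p + t • X) ∈ W) :
    dirDeriv X s p ∈ W := by
  obtain ⟨W', hW'⟩ := W.exists_isCompl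
  let L := W'.projection W hW'.symm
  have hker : ∀ x, x ∈ W ↔ L x = 0 := fun x => by
    rw [← LinearMap.mem_ker, Submodule.ker_projection]
  have h1 : HasDerivAt (fun t : ℝ => L (s (p + t • X))) (L (dirDeriv X s p)) 0 := by
    have hd := hasDerivAt_line (X := X) (p := p) (t := 0) (s := s) (by simpa using hs)
    have := (LinearMap.toContinuousLinearMap L).hasFDerivAt.comp_hasDerivAt 0 hd
    simp only [zero_smul, add_zero] at this
    exact this
  have h2 : HasDerivAt (fun t : ℝ => L (s (p + t • X))) 0 0 :=
    (hasDerivAt_const (0 : ℝ) (0 : LieSpace)).congr_of_eventuallyEq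
      (h.mono fun t ht => (hker _).1 ht)
  exact (hker _).2 (h1.unique h2)

/-- The second derivative version of `dirDeriv_mem`. -/
theorem dirDeriv_dirDeriv_mem {E : ℝ × ℝ → Submodule ℝ LieSpace} {N : Set (ℝ × ℝ)}
    {X p : ℝ × ℝ} {s : ℝ × ℝ → LieSpace} (hs : IsSectionOn E N s) (hp : p ∈ N)
    {W : Submodule ℝ LieSpace} (h : ∀ᶠ t in 𝓝 (0 : ℝ), s (p + t • X) ∈ W) :
    dirDeriv X (dirDeriv X s) p ∈ W := by
  refine dirDeriv_mem (hs.differentiableAt_dirDeriv X hp) ?_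
  filter_upwards [h.eventually_nhds, tendsto_line X p (hs.isOpen.mem_nhds hp)] with t ht htN
  refine dirDeriv_mem (hs.differentiableAt htN) ?_
  have : Tendsto (fun t' : ℝ => t + t') (𝓝 0) (𝓝 t) := by
    have hc : Continuous fun t' : ℝ => t + t' := by fun_prop
    simpa using hc.tendsto 0
  filter_upwards [this.eventually ht] with t' ht'
  rwa [add_smul, ← add_assoc] at ht'

/-! ### Constancy along lines -/

/-- `C` is locally constant along the lines of direction `X` in `U`. -/
def LocallyConstantAlong (C : ℝ × ℝ → Submodule ℝ LieSpace) (X : ℝ × ℝ) (U : Set (ℝ × ℝ)) : Prop :=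
  ∀ p ∈ U, ∀ᶠ t in 𝓝 (0 : ℝ), C (p + t • X) = C p

/-- A line spanned by a vector function `s` with `∂_X s ∈ ⟨s⟩` is constant along `X`. -/
theorem eventually_span_eq {N : Set (ℝ × ℝ)} (hN : IsOpen N) {X p : ℝ × ℝ} (hp : p ∈ N)
    {s : ℝ × ℝ → LieSpace} (hs : ∀ q ∈ N, DifferentiableAt ℝ s q) (h0 : s p ≠ 0)
    (hX : ∀ q ∈ N, dirDeriv X s q ∈ Submodule.span ℝ {s q}) :
    ∀ᶠ t in 𝓝 (0 : ℝ), Submodule.span ℝ {s (p + t • X)} = Submodule.span ℝ {s p} := by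
  obtain ⟨i, hi⟩ : ∃ i, s p i ≠ 0 := by
    by_contra! h
    exact h0 (funext h)
  have hci : ContinuousAt (fun q => s q i) p :=
    continuousAt_pi.1 (hs p hp).continuousAt i
  have hev : ∀ᶠ t in 𝓝 (0 : ℝ), p + t • X ∈ N ∧ s (p + t • X) i ≠ 0 :=
    (tendsto_line X p).eventually ((hN.eventually_mem hp).and
      (hci.eventually_ne hi))
  obtain ⟨ε, hε, hball⟩ := Metric.eventually_nhds_iff_ball.1 hev
  -- Normalizing the `i`-th coordinate to `1` removes the free factor: where `s' = a s`, the
  -- normalized lift has derivative zero.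
  set n : ℝ → LieSpace := fun t => (s (p + t • X) i)⁻¹ • s (p + t • X) with hn
  have hd : ∀ t ∈ Metric.ball (0 : ℝ) ε, HasDerivAt n 0 t := by
    intro t ht
    obtain ⟨htN, hti⟩ := hball t ht
    have h1 := hasDerivAt_line (X := X) (hs _ htN)
    have h2 : HasDerivAt (fun t : ℝ => s (p + t • X) i) (dirDeriv X s (p + t • X) i) t :=
      hasDerivAt_pi.1 h1 i
    obtain ⟨a, ha⟩ := Submodule.mem_span_singleton.1 (hX _ htN)
    refine ((h2.inv hti).smul h1).congr_deriv ?_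
    rw [← ha]
    simp only [Pi.inv_apply, smul_smul, ← add_smul, Pi.smul_apply, smul_eq_mul]
    convert zero_smul ℝ _
    field_simp
    ring
  filter_upwards [Metric.ball_mem_nhds 0 hε] with t ht
  have hconst : n t = n 0 :=
    Metric.isOpen_ball.is_const_of_deriv_eq_zero (convex_ball 0 ε).isPreconnected
      (fun t ht => (hd t ht).differentiableAt.differentiableWithinAt)
      (fun t ht => (hd t ht).deriv) ht (Metric.mem_ball_self hε)
  have hspan : ∀ t ∈ Metric.ball (0 : ℝ) ε,
      Submodule.span ℝ {n t} = Submodule.span ℝ {s (p + t • X)} := fun t ht =>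
    Submodule.span_singleton_smul_eq (inv_ne_zero (hball t ht).2).isUnit _
  rw [← hspan t ht, hconst, hspan 0 (Metric.mem_ball_self hε)]
  simp

theorem LocallyConstantAlong.eq_of_segment {C : ℝ × ℝ → Submodule ℝ LieSpace} {X : ℝ × ℝ}
    {U : Set (ℝ × ℝ)} (h : LocallyConstantAlong C X U) (p : ℝ × ℝ) {I : Set ℝ}
    (hI : IsPreconnected I) (hU : ∀ t ∈ I, p + t • X ∈ U) {a b : ℝ} (ha : a ∈ I) (hb : b ∈ I) :
    C (p + a • X) = C (p + b • X) := by
  refine hI.induction₂ (fun a b => C (p + a • X) = C (p + b • X)) (fun t ht => ?_)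
    (fun _ _ _ _ _ _ h h' => h.trans h') (fun _ _ _ _ h => h.symm) ha hb
  have : Tendsto (fun t' : ℝ => t' - t) (𝓝[I] t) (𝓝 0) := by
    have hc : Continuous fun t' : ℝ => t' - t := by fun_prop
    simpa using (hc.tendsto t).mono_left nhdsWithin_le_nhds
  filter_upwards [this.eventually (h _ (hU t ht))] with t' ht'
  rw [← ht', add_assoc, ← add_smul]
  simp

/-- The local form makes sense for any direction, so a single argument can serve both coordinate
directions. Passing back to segments uses their connectedness. -/
theorem isConstantAlongU_iff {C : ℝ × ℝ → Submodule ℝ LieSpace} {U : Set (ℝ × ℝ)}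
    (hU : IsOpen U) : IsConstantAlongU C U ↔ LocallyConstantAlong C dirU U := by
  constructor
  · rintro h ⟨u, v⟩ hp
    obtain ⟨ε, hε, hball⟩ := Metric.eventually_nhds_iff_ball.1
      ((tendsto_line dirU (u, v)).eventually (hU.eventually_mem hp))
    filter_upwards [Metric.ball_mem_nhds 0 hε] with t ht
    have := h u (u + t) v fun t' ht' => by
      have hmem : t' - u ∈ Metric.ball (0 : ℝ) ε := by
        refine (convex_ball (0 : ℝ) ε).ordConnected.uIcc_subset (Metric.mem_ball_self hε) ht ?_
        rw [Set.mem_uIcc] at ht' ⊢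
        rcases ht' with ⟨_, _⟩ | ⟨_, _⟩
        · left; constructor <;> linarith
        · right; constructor <;> linarith
      simpa using hball _ hmem
    simpa [eq_comm] using this
  · intro h u u' v hseg
    simpa using h.eq_of_segment (0, v) isPreconnected_uIcc (I := Set.uIcc u u')
      (by simpa using hseg) Set.left_mem_uIcc Set.right_mem_uIcc

theorem isConstantAlongV_iff {C : ℝ × ℝ → Submodule ℝ LieSpace} {U : Set (ℝ × ℝ)}
    (hU : IsOpen U) : IsConstantAlongV C U ↔ LocallyConstantAlong C dirV U := by
  constructor
  · rintro h ⟨u, v⟩ hp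
    obtain ⟨ε, hε, hball⟩ := Metric.eventually_nhds_iff_ball.1
      ((tendsto_line dirV (u, v)).eventually (hU.eventually_mem hp))
    filter_upwards [Metric.ball_mem_nhds 0 hε] with t ht
    have := h u v (v + t) fun t' ht' => by
      have hmem : t' - v ∈ Metric.ball (0 : ℝ) ε := by
        refine (convex_ball (0 : ℝ) ε).ordConnected.uIcc_subset (Metric.mem_ball_self hε) ht ?_
        rw [Set.mem_uIcc] at ht' ⊢
        rcases ht' with ⟨_, _⟩ | ⟨_, _⟩
        · left; constructor <;> linarith
        · right; constructor <;> linarith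
      simpa using hball _ hmem
    simpa [eq_comm] using this
  · intro h u v v' hseg
    simpa using h.eq_of_segment (u, 0) isPreconnected_uIcc (I := Set.uIcc v v')
      (by simpa using hseg) Set.left_mem_uIcc Set.right_mem_uIcc

/-! ### Curvature spheres of a Legendre map -/

section Legendre

variable {f : ℝ × ℝ → Submodule ℝ LieSpace} {U N N' : Set (ℝ × ℝ)} {p X Y : ℝ × ℝ}
  {s t w : ℝ × ℝ → LieSpace}

theorem IsContactElement.eq_span {W : Submodule ℝ LieSpace} (hW : IsContactElement W)
    {x y : LieSpace} (hx : x ∈ W) (hy : y ∈ W) (hx0 : x ≠ 0) (hxy : y ∉ Submodule.span ℝ {x}) :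
    W = Submodule.span ℝ {x, y} := by
  have hli : LinearIndependent ℝ ![x, y] :=
    (LinearIndependent.pair_iff' hx0).2 fun a ha =>
      hxy (Submodule.mem_span_singleton.2 ⟨a, ha⟩)
  have h := finrank_span_eq_card hli
  rw [Matrix.range_cons_cons_empty, Fintype.card_fin] at h
  have : FiniteDimensional ℝ W := inferInstance
  refine (Submodule.eq_of_le_of_finrank_eq ?_ (by rw [h, hW.1])).symm
  rw [Submodule.span_le]
  rintro z (rfl | rfl) <;> assumption

theorem IsContactElement.exists_combination {W : Submodule ℝ LieSpace} (hW : IsContactElement W)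
    {x y z : LieSpace} (hx : x ∈ W) (hy : y ∈ W) (hx0 : x ≠ 0)
    (hxy : y ∉ Submodule.span ℝ {x}) (hz : z ∈ W) : ∃ a b : ℝ, a • x + b • y = z := by
  rw [hW.eq_span hx hy hx0 hxy] at hz
  exact Submodule.mem_span_pair.1 hz

theorem IsLegendreMap.exists_section (hf : IsLegendreMap f U) (hp : p ∈ U) {x : LieSpace}
    (hx : x ∈ f p) : ∃ N, p ∈ N ∧ ∃ s, IsSectionOn f N s ∧ s p = x := by
  obtain ⟨N, hpN, s, t, hs, ht, hst⟩ := hf.smooth p hp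
  rw [hst p hpN] at hx
  obtain ⟨a, b, hab⟩ := Submodule.mem_span_pair.1 hx
  exact ⟨N, hpN, a • s + b • t, (hs.const_smul a).add (ht.const_smul b), hab⟩

theorem IsLegendreMap.orth_dirDeriv (hf : IsLegendreMap f U) (hp : p ∈ U)
    (hs : IsSectionOn f N s) (hpN : p ∈ N) (X : ℝ × ℝ) {y : LieSpace} (hy : y ∈ f p) :
    lieForm (dirDeriv X s p) y = 0 := by
  obtain ⟨N', hpN', t, ht, rfl⟩ := hf.exists_section hp hy
  rw [lieForm_comm]
  have hs' : IsSectionOn f (N ∩ N') s := hs.inter ht.isOpen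
  have ht' : IsSectionOn f (N ∩ N') t := Set.inter_comm N' N ▸ ht.inter hs.isOpen
  exact hf.contact p hp (N ∩ N') ⟨hpN, hpN'⟩ t s ht' hs' X

theorem IsLegendreMap.pos_dirDeriv (hf : IsLegendreMap f U) (hp : p ∈ U)
    (hs : IsSectionOn f N s) (hpN : p ∈ N) (h : dirDeriv X s p ∉ f p) :
    0 < lieForm (dirDeriv X s p) (dirDeriv X s p) :=
  (hf.contactElement p hp).pos_of_orth (fun _ hy => hf.orth_dirDeriv hp hs hpN X hy) h

/-- For sections `s`, `t` of a Legendre map, `⟨∂_X s, ∂_Y t⟩` is symmetric in `X`, `Y`. -/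
theorem IsLegendreMap.codazzi (hf : IsLegendreMap f U) (hU : IsOpen U) (hp : p ∈ U)
    (hs : IsSectionOn f N s) (ht : IsSectionOn f N t) (hpN : p ∈ N) (X Y : ℝ × ℝ) :
    lieForm (dirDeriv X s p) (dirDeriv Y t p) = lieForm (dirDeriv Y s p) (dirDeriv X t p) := by
  -- This is the contact condition `⟨s, t_Y⟩ = 0` differentiated along `X`; its second-order term is
  -- symmetric in `X` and `Y`.
  have key : ∀ X Y, lieForm (s p) (dirDeriv X (dirDeriv Y t) p) +
      lieForm (dirDeriv X s p) (dirDeriv Y t p) = 0 := fun X Y => by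
    refine lieForm_dirDeriv_add_eq_zero (hs.differentiableAt hpN)
      (ht.differentiableAt_dirDeriv Y hpN) ?_ X
    filter_upwards [hU.mem_nhds hp, hs.isOpen.mem_nhds hpN] with q hq hqN
    exact hf.contact q hq N hqN s t hs ht Y
  have h1 := key X Y
  have h2 := key Y X
  rw [dirDeriv_comm (ht.contDiffAt hpN) Y X] at h2
  linarith

/-- Differentiating `⟨s, s_X⟩ = 0` at a zero of `s` gives `⟨s_X, s_X⟩ = 0`, and an isotropic vector
orthogonal to `f p` lies in it. This replaces an expansion of `s` in a smooth frame. -/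
theorem IsLegendreMap.dirDeriv_mem_of_eq_zero (hf : IsLegendreMap f U) (hU : IsOpen U)
    (hp : p ∈ U) (hs : IsSectionOn f N s) (hpN : p ∈ N) (h0 : s p = 0) :
    dirDeriv X s p ∈ f p := by
  refine (hf.contactElement p hp).mem_of_orth (fun _ hy => hf.orth_dirDeriv hp hs hpN X hy) ?_
  have := lieForm_dirDeriv_add_eq_zero (hs.differentiableAt hpN)
    (hs.differentiableAt_dirDeriv X hpN) (by
      filter_upwards [hU.mem_nhds hp, hs.isOpen.mem_nhds hpN] with q hq hqN
      exact hf.contact q hq N hqN s s hs hs X) X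
  rw [h0] at this
  simpa using this.le

/-- Modulo `f p` the derivative of a section depends only, and linearly, on its value at `p`: the
difference of both sides is a section vanishing there. -/
theorem IsLegendreMap.dirDeriv_sub_mem (hf : IsLegendreMap f U) (hU : IsOpen U)
    (hp : p ∈ U) (hs : IsSectionOn f N s) (ht : IsSectionOn f N t) (hw : IsSectionOn f N w)
    (hpN : p ∈ N) {a b : ℝ} (h : s p = a • t p + b • w p) (X : ℝ × ℝ) :
    dirDeriv X s p - (a • dirDeriv X t p + b • dirDeriv X w p) ∈ f p := by
  have hat := (ht.const_smul a).add (hw.const_smul b)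
  have := hf.dirDeriv_mem_of_eq_zero (X := X) hU hp (hs.add (hat.const_smul (-1))) hpN
    (by simp only [Pi.add_apply, Pi.smul_apply, h]; module)
  rw [dirDeriv_add (hs.differentiableAt hpN) ((hat.const_smul _).differentiableAt hpN),
    dirDeriv_const_smul (hat.differentiableAt hpN),
    dirDeriv_add ((ht.const_smul a).differentiableAt hpN)
      ((hw.const_smul b).differentiableAt hpN),
    dirDeriv_const_smul (ht.differentiableAt hpN),
    dirDeriv_const_smul (hw.differentiableAt hpN)] at this
  rwa [neg_one_smul, ← sub_eq_add_neg] at this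

/-- Whether `x` is a curvature sphere may be tested on any section through `x`. -/
theorem IsLegendreMap.dirDeriv_mem (hf : IsLegendreMap f U) (hU : IsOpen U)
    (hp : p ∈ U) (hs : IsSectionOn f N s) (hpN : p ∈ N)
    (h : IsCurvatureSphere f p X (s p)) : dirDeriv X s p ∈ f p := by
  obtain ⟨-, N', hpN', t, ht, hts, hX⟩ := h
  have hs' : IsSectionOn f (N ∩ N') s := hs.inter ht.isOpen
  have ht' : IsSectionOn f (N ∩ N') t := Set.inter_comm N' N ▸ ht.inter hs.isOpen
  have := hf.dirDeriv_sub_mem (a := 1) (b := 0) hU hp hs' ht' ht' ⟨hpN, hpN'⟩ (by simp [hts]) X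
  have := add_mem this hX
  simpa using this

theorem IsCurvatureSphere.mem {x : LieSpace} (h : IsCurvatureSphere f p X x) : x ∈ f p := by
  obtain ⟨-, N, hpN, s, hs, rfl, -⟩ := h
  exact hs.mem p hpN

theorem IsCurvatureSphere.of_mem_span {x y : LieSpace} (h : IsCurvatureSphere f p X x)
    (hy : y ∈ Submodule.span ℝ {x}) (hy0 : y ≠ 0) : IsCurvatureSphere f p X y := by
  obtain ⟨-, N, hpN, s, hs, rfl, hX⟩ := h
  obtain ⟨a, rfl⟩ := Submodule.mem_span_singleton.1 hy
  refine ⟨hy0, N, hpN, a • s, hs.const_smul a, rfl, ?_⟩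
  rw [dirDeriv_const_smul (hs.differentiableAt hpN)]
  exact (f p).smul_mem a hX

/-- For each direction there is at most one curvature sphere. -/
theorem IsLegendreMap.curvatureSphere_unique (hf : IsLegendreMap f U) (hU : IsOpen U)
    (hp : p ∈ U) (hX : X ≠ 0) {x y : LieSpace} (hx : IsCurvatureSphere f p X x)
    (hy : IsCurvatureSphere f p X y) : y ∈ Submodule.span ℝ {x} := by
  by_contra hxy
  -- Two independent curvature spheres for `X` would span `f p`, so every section would have its
  -- `X`-derivative in `f p`, against immersion.
  obtain ⟨N, hpN, s, hs, hsX⟩ := hf.immersion p hp X hX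
  obtain ⟨a, b, hab⟩ := (hf.contactElement p hp).exists_combination hx.mem hy.mem hx.1 hxy
    (hs.mem p hpN)
  obtain ⟨-, N₁, hpN₁, t, ht, rfl, htX⟩ := hx
  obtain ⟨-, N₂, hpN₂, w, hw, rfl, hwX⟩ := hy
  have hN : IsOpen (N ∩ N₁ ∩ N₂) := (hs.isOpen.inter ht.isOpen).inter hw.isOpen
  have := hf.dirDeriv_sub_mem hU hp (hs.mono hN (fun q hq => hq.1.1) fun _ _ h => h)
    (ht.mono hN (fun q hq => hq.1.2) fun _ _ h => h)
    (hw.mono hN (fun q hq => hq.2) fun _ _ h => h) ⟨⟨hpN, hpN₁⟩, hpN₂⟩ hab.symm X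
  have := add_mem this (add_mem ((f p).smul_mem a htX) ((f p).smul_mem b hwX))
  exact hsX (by simpa using this)

/-- Without umbilics no sphere is a curvature sphere for two independent directions. -/
theorem IsLegendreMap.not_isCurvatureSphere (hf : IsLegendreMap f U) (hU : IsOpen U)
    (hp : p ∈ U) (humb : IsUmbilicFree f U) (hXY : ∀ Z : ℝ × ℝ, ∃ a b : ℝ, Z = a • X + b • Y)
    {x : LieSpace} (hx : IsCurvatureSphere f p X x) : ¬ IsCurvatureSphere f p Y x := by
  intro hy
  refine humb p hp ⟨x, fun Z _ => ?_⟩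
  obtain ⟨a, b, rfl⟩ := hXY Z
  obtain ⟨hx0, N, hpN, s, hs, rfl, hX⟩ := hx
  refine ⟨hx0, N, hpN, s, hs, rfl, ?_⟩
  have : dirDeriv (a • X + b • Y) s p = a • dirDeriv X s p + b • dirDeriv Y s p := by
    simp [dirDeriv]
  rw [this]
  exact add_mem ((f p).smul_mem a hX) ((f p).smul_mem b (hf.dirDeriv_mem hU hp hs hpN hy))

/-- Every curvature sphere is one of the two belonging to the basis `X`, `Y` of curvature
directions. -/
theorem IsLegendreMap.curvatureSphere_dichotomy (hf : IsLegendreMap f U) (hU : IsOpen U)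
    (hp : p ∈ U) (humb : IsUmbilicFree f U) (hXY : ∀ Z : ℝ × ℝ, ∃ a b : ℝ, Z = a • X + b • Y)
    {x y z : LieSpace} (hx : IsCurvatureSphere f p X x) (hy : IsCurvatureSphere f p Y y)
    {Z : ℝ × ℝ} (hZ : Z ≠ 0) (hz : IsCurvatureSphere f p Z z) :
    z ∈ Submodule.span ℝ {x} ∨ z ∈ Submodule.span ℝ {y} := by
  have hyX : ¬ IsCurvatureSphere f p X y := fun h =>
    hf.not_isCurvatureSphere hU hp humb hXY h hy
  have hxY : ¬ IsCurvatureSphere f p Y x := hf.not_isCurvatureSphere hU hp humb hXY hx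
  have hxy : y ∉ Submodule.span ℝ {x} := fun h => hyX (hx.of_mem_span h hy.1)
  obtain ⟨α, β, hαβ⟩ := (hf.contactElement p hp).exists_combination hx.mem hy.mem hx.1 hxy hz.mem
  obtain ⟨hx0, N₁, hpN₁, s, hs, rfl, hsX⟩ := hx
  obtain ⟨hy0, N₂, hpN₂, t, ht, rfl, htY⟩ := hy
  obtain ⟨hz0, N₃, hpN₃, w, hw, rfl, hwZ⟩ := hz
  have htX : dirDeriv X t p ∉ f p := fun h => hyX ⟨hy0, N₂, hpN₂, t, ht, rfl, h⟩
  have hsY : dirDeriv Y s p ∉ f p := fun h => hxY ⟨hx0, N₁, hpN₁, s, hs, rfl, h⟩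
  have hN : IsOpen (N₁ ∩ N₂ ∩ N₃) := (hs.isOpen.inter ht.isOpen).inter hw.isOpen
  replace hs : IsSectionOn f _ s := hs.mono hN (fun q hq => hq.1.1) fun _ _ h => h
  replace ht : IsSectionOn f _ t := ht.mono hN (fun q hq => hq.1.2) fun _ _ h => h
  replace hw : IsSectionOn f _ w := hw.mono hN (fun q hq => hq.2) fun _ _ h => h
  have hpN : p ∈ N₁ ∩ N₂ ∩ N₃ := ⟨⟨hpN₁, hpN₂⟩, hpN₃⟩
  obtain ⟨a, b, rfl⟩ := hXY Z
  have hcross : lieForm (dirDeriv X t p) (dirDeriv Y s p) = 0 := by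
    rw [hf.codazzi hU hp ht hs hpN, lieForm_comm]
    exact hf.orth_dirDeriv hp hs hpN X htY
  -- Expand `∂_Z w` for `Z = aX + bY` and `w = αs + βt` modulo `f p`; the terms `s_X` and `t_Y` drop
  -- out. Since `t_X` and `s_Y` are orthogonal of positive norm, `aβ = bα = 0`, and `Z ≠ 0` forces
  -- `α = 0` or `β = 0`.
  have hmem : (a * β) • dirDeriv X t p + (b * α) • dirDeriv Y s p ∈ f p := by
    have e1 := hf.dirDeriv_sub_mem hU hp hw hs ht hpN hαβ.symm X
    have e2 := hf.dirDeriv_sub_mem hU hp hw hs ht hpN hαβ.symm Y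
    have e3 : dirDeriv (a • X + b • Y) w p = a • dirDeriv X w p + b • dirDeriv Y w p := by
      simp [dirDeriv]
    rw [e3] at hwZ
    have e4 := sub_mem hwZ (add_mem (add_mem ((f p).smul_mem a e1) ((f p).smul_mem b e2))
      (add_mem ((f p).smul_mem (a * α) hsX) ((f p).smul_mem (b * β) htY)))
    convert e4 using 1
    module
  have h1 := hf.orth_dirDeriv hp ht hpN X hmem
  have h2 := hf.orth_dirDeriv hp hs hpN Y hmem
  have htt := (hf.pos_dirDeriv hp ht hpN htX).ne'
  have hss := (hf.pos_dirDeriv hp hs hpN hsY).ne'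
  simp only [map_add, map_smul, smul_eq_mul, hcross, mul_zero, add_zero, mul_eq_zero, htt,
    or_false] at h1
  simp only [map_add, map_smul, smul_eq_mul, lieForm_comm _ (dirDeriv X t p), hcross, mul_zero,
    zero_add, mul_eq_zero, hss, or_false] at h2
  rw [← hαβ]
  by_cases hβ : β = 0
  · left
    rw [hβ, zero_smul, add_zero]
    exact Submodule.smul_mem _ _ (Submodule.mem_span_singleton_self _)
  by_cases hα : α = 0
  · right
    rw [hα, zero_smul, zero_add]
    exact Submodule.smul_mem _ _ (Submodule.mem_span_singleton_self _)
  exact absurd (by simp [h1.resolve_right hβ, h2.resolve_right hα]) hZ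

/-- A section which is no curvature sphere for `X` osculates a `(2,1)`-plane along `X`. -/
theorem IsLegendreMap.isPlane21_osculating (hf : IsLegendreMap f U) (hU : IsOpen U) (hp : p ∈ U)
    (hs : IsSectionOn f N s) (hpN : p ∈ N) (h : dirDeriv X s p ∉ f p) :
    IsPlane21 (Submodule.span ℝ {s p, dirDeriv X s p, dirDeriv X (dirDeriv X s) p}) := by
  refine isPlane21_span_of_gram ((hf.contactElement p hp).2 _ (hs.mem p hpN) _ (hs.mem p hpN))
    (hf.contact p hp N hpN s s hs hs X) (hf.pos_dirDeriv hp hs hpN h) ?_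
  have := lieForm_dirDeriv_add_eq_zero (hs.differentiableAt hpN)
    (hs.differentiableAt_dirDeriv X hpN) (by
      filter_upwards [hU.mem_nhds hp, hs.isOpen.mem_nhds hpN] with q hq hqN
      exact hf.contact q hq N hqN s s hs hs X) X
  linarith

end Legendre

/-! ### Transversal sphere congruences and smooth lifts -/

/-- `R` is a smooth sphere congruence enveloped by `f` which is nowhere a curvature sphere. -/
structure IsTransversalSphereCongruence (R f : ℝ × ℝ → Submodule ℝ LieSpace)
    (U : Set (ℝ × ℝ)) : Prop where
  le : ∀ p ∈ U, R p ≤ f p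
  finrank_eq : ∀ p ∈ U, Module.finrank ℝ (R p) = 1
  lift : ∀ p ∈ U, ∃ N, p ∈ N ∧ N ⊆ U ∧ ∃ r, IsSectionOn R N r ∧ ∀ q ∈ N, r q ≠ 0
  transversal : ∀ p ∈ U, ∀ X, X ≠ 0 → ∀ x ∈ R p, ¬ IsCurvatureSphere f p X x

section

variable {f g R : ℝ × ℝ → Submodule ℝ LieSpace} {U N : Set (ℝ × ℝ)} {p q X Y : ℝ × ℝ}
  {r : ℝ × ℝ → LieSpace}

theorem IsSectionOn.inter_of_ne_zero {E : ℝ × ℝ → Submodule ℝ LieSpace} {s : ℝ × ℝ → LieSpace}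
    (hs : IsSectionOn E N s) : IsOpen (N ∩ {q | s q ≠ 0}) :=
  hs.smooth.continuousOn.isOpen_inter_preimage hs.isOpen isOpen_ne

/-- Take sections `s` of `f` and `w` of `g` with `⟨s, w⟩ ≠ 0`. Inside `f` the common line is then
the orthogonal complement of `w`, and a section of `f` is moved into it smoothly by subtracting a
multiple of `s`. Starting from a section through a common sphere at `p` keeps the result nonzero
there. -/
theorem IsRibaucourPair.exists_lift (hfg : IsRibaucourPair f g U) (hU : IsOpen U) (hp : p ∈ U) :
    ∃ N, p ∈ N ∧ N ⊆ U ∧ ∃ r, IsSectionOn (ribaucourSphere f g) N r ∧ ∀ q ∈ N, r q ≠ 0 := by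
  have hcf := hfg.left.contactElement
  have hcg := hfg.right.contactElement
  obtain ⟨z, hz, hz0⟩ : ∃ z ∈ f p ⊓ g p, z ≠ 0 := by
    refine Submodule.exists_mem_ne_zero_of_ne_bot fun h => ?_
    have := hfg.envelop p hp
    rw [h, finrank_bot] at this
    exact zero_ne_one this
  obtain ⟨x, hx, hxg⟩ : ∃ x ∈ f p, x ∉ g p := by
    by_contra! h
    have := hfg.envelop p hp
    rw [inf_eq_left.2 h, (hcf p hp).1] at this
    omega
  obtain ⟨y, hy, hxy⟩ : ∃ y ∈ g p, lieForm x y ≠ 0 := by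
    by_contra! h
    exact hxg ((hcg p hp).mem_of_orth h ((hcf p hp).2 x hx x hx).le)
  obtain ⟨N₁, hp₁, s, hs, rfl⟩ := hfg.left.exists_section hp hx
  obtain ⟨N₂, hp₂, t, ht, rfl⟩ := hfg.left.exists_section hp hz.1
  obtain ⟨N₃, hp₃, w, hw, rfl⟩ := hfg.right.exists_section hp hy
  set N := N₁ ∩ N₂ ∩ N₃ ∩ U
  have hN : IsOpen N := ((hs.isOpen.inter ht.isOpen).inter hw.isOpen).inter hU
  replace hs : IsSectionOn f N s := hs.mono hN (fun q hq => hq.1.1.1) fun _ _ h => h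
  replace ht : IsSectionOn f N t := ht.mono hN (fun q hq => hq.1.1.2) fun _ _ h => h
  replace hw : IsSectionOn g N w := hw.mono hN (fun q hq => hq.1.2) fun _ _ h => h
  have hpN : p ∈ N := ⟨⟨⟨hp₁, hp₂⟩, hp₃⟩, hp⟩
  have hsw := contDiffOn_lieForm hs.smooth hw.smooth
  set N' := N ∩ (fun q => lieForm (s q) (w q)) ⁻¹' {0}ᶜ
  have hN' : IsOpen N' := hsw.continuousOn.isOpen_inter_preimage hN isOpen_compl_singleton
  set r : ℝ × ℝ → LieSpace :=
    t + fun q => (-(lieForm (t q) (w q) / lieForm (s q) (w q))) • s q with hr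
  have hrf : IsSectionOn f N' r := by
    refine (ht.mono hN' Set.inter_subset_left fun _ _ h => h).add
      ((hs.mono hN' Set.inter_subset_left fun _ _ h => h).smul ?_)
    exact ((contDiffOn_lieForm (ht.smooth.mono Set.inter_subset_left)
      (hw.smooth.mono Set.inter_subset_left)).div (hsw.mono Set.inter_subset_left)
      fun q hq => hq.2).neg
  have hrg : ∀ q ∈ N', r q ∈ g q := by
    intro q hq
    have hqU : q ∈ U := hq.1.2
    obtain ⟨n, hn, hn0⟩ : ∃ n ∈ f q ⊓ g q, n ≠ 0 := by
      refine Submodule.exists_mem_ne_zero_of_ne_bot fun h => ?_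
      have := hfg.envelop q hqU
      rw [h, finrank_bot] at this
      exact zero_ne_one this
    have hsn : s q ∉ Submodule.span ℝ {n} := fun h =>
      hq.2 ((hcg q hqU).2 _ ((Submodule.span_singleton_le_iff_mem n (g q)).2 hn.2 h)
        _ (hw.mem q hq.1))
    obtain ⟨a, b, hab⟩ := (hcf q hqU).exists_combination hn.1 (hs.mem q hq.1) hn0 hsn
      (ht.mem q hq.1)
    have hb : lieForm (t q) (w q) / lieForm (s q) (w q) = b := by
      rw [← hab]
      simp only [map_add, map_smul, LinearMap.add_apply, LinearMap.smul_apply, smul_eq_mul,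
        (hcg q hqU).2 n hn.2 _ (hw.mem q hq.1), mul_zero, zero_add]
      exact mul_div_cancel_right₀ b hq.2
    have : r q = a • n := by
      simp only [hr, Pi.add_apply, hb]
      rw [← hab]
      module
    rw [this]
    exact (g q).smul_mem a hn.2
  have hrR : IsSectionOn (ribaucourSphere f g) N' r :=
    ⟨hN', hrf.smooth, fun q hq => ⟨hrf.mem q hq, hrg q hq⟩⟩
  refine ⟨N' ∩ {q | r q ≠ 0}, ⟨⟨hpN, hxy⟩, ?_⟩, fun q hq => hq.1.1.2, r,
    hrR.mono hrR.inter_of_ne_zero Set.inter_subset_left fun _ _ h => h, fun q hq => hq.2⟩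
  simpa [hr, (hcg p hp).2 _ hz.2 _ hy] using hz0

theorem IsTransversalSphereCongruence.dirDeriv_notMem (hR : IsTransversalSphereCongruence R f U)
    (hN : N ⊆ U) (hr : IsSectionOn R N r) (hr0 : ∀ q ∈ N, r q ≠ 0) (hq : q ∈ N) (hX : X ≠ 0) :
    dirDeriv X r q ∉ f q := fun h =>
  hR.transversal q (hN hq) X hX (r q) (hr.mem q hq)
    ⟨hr0 q hq, N, hq, r, hr.mono hr.isOpen le_rfl fun q hq h => hR.le q (hN hq) h, rfl, h⟩

theorem IsTransversalSphereCongruence.section_left (hR : IsTransversalSphereCongruence R f U)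
    (hN : N ⊆ U) (hr : IsSectionOn R N r) : IsSectionOn f N r :=
  hr.mono hr.isOpen le_rfl fun q hq h => hR.le q (hN hq) h

theorem IsTransversalSphereCongruence.isPlane21 (hR : IsTransversalSphereCongruence R f U)
    (hf : IsLegendreMap f U) (hU : IsOpen U) (hp : p ∈ U) (hX : X ≠ 0) :
    IsPlane21 (osculatingSpace R X p) := by
  obtain ⟨N, hpN, hN, r, hr, hr0⟩ := hR.lift p hp
  rw [osculatingSpace_eq (fun q hq => hR.finrank_eq q (hN hq)) hr hr0 X hpN]
  exact hf.isPlane21_osculating hU hp (hR.section_left hN hr) hpN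
    (hR.dirDeriv_notMem hN hr hr0 hpN hX)

theorem IsRibaucourPair.isTransversalSphereCongruence_left (hfg : IsRibaucourPair f g U)
    (hU : IsOpen U)
    (hr : ∀ p ∈ U, ∀ X, X ≠ 0 → ∀ x ∈ ribaucourSphere f g p, ¬ IsCurvatureSphere f p X x) :
    IsTransversalSphereCongruence (ribaucourSphere f g) f U :=
  ⟨fun _ _ => inf_le_left, hfg.envelop, fun _ hp => hfg.exists_lift hU hp, hr⟩

/-- Transversality passes from `f` to `g` through the norm of `r_X`: it is positive because `r_X` is
not in `f`, but would vanish if `r_X` were in `g`. -/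
theorem IsRibaucourPair.isTransversalSphereCongruence_right (hfg : IsRibaucourPair f g U)
    (hU : IsOpen U)
    (hr : ∀ p ∈ U, ∀ X, X ≠ 0 → ∀ x ∈ ribaucourSphere f g p, ¬ IsCurvatureSphere f p X x) :
    IsTransversalSphereCongruence (ribaucourSphere f g) g U := by
  have hR := hfg.isTransversalSphereCongruence_left hU hr
  refine ⟨fun _ _ => inf_le_right, hfg.envelop, hR.lift, fun p hp X hX x hx hxc => ?_⟩
  obtain ⟨N, hpN, hN, r, hr, hr0⟩ := hR.lift p hp
  obtain ⟨a, ha⟩ := (finrank_eq_one_iff_of_nonzero' (⟨x, hx⟩ : ribaucourSphere f g p)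
    (by simpa using hxc.1)).1 (hR.finrank_eq p hp) ⟨r p, hr.mem p hpN⟩
  have hrp : IsCurvatureSphere g p X (r p) := hxc.of_mem_span
    (Submodule.mem_span_singleton.2 ⟨a, congrArg Subtype.val ha⟩) (hr0 p hpN)
  have hrg : IsSectionOn g N r := hr.mono hr.isOpen le_rfl fun q _ h => h.2
  have hmem := hfg.right.dirDeriv_mem hU hp hrg hpN hrp
  have hpos := hfg.left.pos_dirDeriv hp (hR.section_left hN hr) hpN
    (hR.dirDeriv_notMem hN hr hr0 hpN hX)
  exact hpos.ne' ((hfg.right.contactElement p hp).2 _ hmem _ hmem)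

theorem IsTransversalSphereCongruence.notMem_span (hR : IsTransversalSphereCongruence R f U)
    (hp : p ∈ U) (hX : X ≠ 0) {x y : LieSpace} (hx : IsCurvatureSphere f p X x) (hy : y ∈ R p)
    (hy0 : y ≠ 0) : y ∉ Submodule.span ℝ {x} := fun h =>
  hR.transversal p hp X hX y hy (hx.of_mem_span h hy0)

/-- The curvature spheres for a direction `X` admit smooth local lifts. -/
theorem IsTransversalSphereCongruence.exists_curvatureSphere_section
    (hR : IsTransversalSphereCongruence R f U) (hf : IsLegendreMap f U) (hU : IsOpen U)
    (hX : ∀ q ∈ U, IsCurvatureDirection f q X) (hp : p ∈ U) :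
    ∃ N, p ∈ N ∧ N ⊆ U ∧ ∃ s, IsSectionOn f N s ∧ ∀ q ∈ N, IsCurvatureSphere f q X (s q) := by
  have hX0 : X ≠ 0 := (hX p hp).1
  obtain ⟨k, hk⟩ := (hX p hp).2
  obtain ⟨N₁, hp₁, hN₁, r, hr, hr0⟩ := hR.lift p hp
  obtain ⟨hk0, N₂, hp₂, t, ht, rfl, htX⟩ := hk
  have hN : IsOpen (N₁ ∩ N₂) := hr.isOpen.inter ht.isOpen
  set N := N₁ ∩ N₂
  have hNU : N ⊆ U := fun q hq => hN₁ hq.1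
  replace hr : IsSectionOn R N r := hr.mono hN Set.inter_subset_left fun _ _ h => h
  replace ht : IsSectionOn f N t := ht.mono hN Set.inter_subset_right fun _ _ h => h
  replace hr0 : ∀ q ∈ N, r q ≠ 0 := fun q hq => hr0 q hq.1
  have hrf := hR.section_left hNU hr
  have hpN : p ∈ N := ⟨hp₁, hp₂⟩
  have hpos : ∀ q ∈ N, 0 < lieForm (dirDeriv X r q) (dirDeriv X r q) := fun q hq =>
    hf.pos_dirDeriv (hNU hq) hrf hq (hR.dirDeriv_notMem hNU hr hr0 hq hX0)
  have hrX := contDiffOn_dirDeriv hN hr.smooth X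
  -- If `t = a k + b r` with `k` the curvature sphere, then `t_X ≡ b r_X` modulo `f`, so the
  -- quotient is `b` and `t - b r = a k`. This expresses the curvature sphere by smooth data.
  set s : ℝ × ℝ → LieSpace := t + fun q => (-(lieForm (dirDeriv X t q) (dirDeriv X r q) /
    lieForm (dirDeriv X r q) (dirDeriv X r q))) • r q with hs
  have hsf : IsSectionOn f N s := ht.add (hrf.smul
    ((contDiffOn_lieForm (contDiffOn_dirDeriv hN ht.smooth X) hrX).div
      (contDiffOn_lieForm hrX hrX) fun q hq => (hpos q hq).ne').neg)
  refine ⟨N ∩ {q | s q ≠ 0}, ⟨hpN, ?_⟩, fun q hq => hNU hq.1, s,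
    hsf.mono hsf.inter_of_ne_zero Set.inter_subset_left fun _ _ h => h, fun q hq => ?_⟩
  · have : lieForm (dirDeriv X t p) (dirDeriv X r p) = 0 := by
      rw [lieForm_comm]
      exact hf.orth_dirDeriv hp hrf hpN X htX
    simpa [hs, this] using hk0
  · obtain ⟨k, hk⟩ := (hX q (hNU hq.1)).2
    have hqN := hq.1
    have hqU := hNU hq.1
    obtain ⟨a, b, hab⟩ := (hf.contactElement q hqU).exists_combination hk.mem
      (hrf.mem q hqN) hk.1 (hR.notMem_span hqU hX0 hk (hr.mem q hqN) (hr0 q hqN)) (ht.mem q hqN)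
    have hk' := hk
    obtain ⟨-, N₃, hq₃, w, hw, rfl, hwX⟩ := hk'
    have hN₃ : IsOpen (N ∩ N₃) := hN.inter hw.isOpen
    have e := hf.dirDeriv_sub_mem hU hqU (ht.inter hw.isOpen)
      (hw.mono hN₃ Set.inter_subset_right fun _ _ h => h) (hrf.inter hw.isOpen) ⟨hqN, hq₃⟩
      hab.symm X
    have e2 := add_mem e ((f q).smul_mem a hwX)
    have e3 : dirDeriv X t q - b • dirDeriv X r q ∈ f q := by
      convert e2 using 1
      module
    have e4 := hf.orth_dirDeriv hqU hrf hqN X e3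
    have hb : lieForm (dirDeriv X t q) (dirDeriv X r q) /
        lieForm (dirDeriv X r q) (dirDeriv X r q) = b := by
      rw [div_eq_iff (hpos q hqN).ne', lieForm_comm]
      simpa [sub_eq_zero] using e4
    refine hk.of_mem_span (Submodule.mem_span_singleton.2 ⟨a, ?_⟩) hq.2
    simp only [hs, Pi.add_apply, hb]
    rw [← hab]
    module

end

/-! ### Dupin splittings: from Dupin cyclides to constant osculating planes -/

/-- The splitting `D ⊕ D'` exhibits `f` as a Dupin cyclide, where the curvature spheres for `X`
lie in `D` and those for `Y` in `D'`. -/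
structure IsDupinSplitting (f : ℝ × ℝ → Submodule ℝ LieSpace) (D D' : Submodule ℝ LieSpace)
    (X Y : ℝ × ℝ) (U : Set (ℝ × ℝ)) : Prop where
  left : IsPlane21 D
  right : IsPlane21 D'
  orth : ∀ x ∈ D, ∀ y ∈ D', lieForm x y = 0
  sphere_left : ∀ p ∈ U, ∃ x ∈ D, IsCurvatureSphere f p X x
  sphere_right : ∀ p ∈ U, ∃ y ∈ D', IsCurvatureSphere f p Y y

section

variable {f g R : ℝ × ℝ → Submodule ℝ LieSpace} {U N : Set (ℝ × ℝ)} {p q X Y : ℝ × ℝ}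
  {r : ℝ × ℝ → LieSpace} {D D' : Submodule ℝ LieSpace}

theorem IsDupinSplitting.swap (h : IsDupinSplitting f D D' X Y U) :
    IsDupinSplitting f D' D Y X U :=
  ⟨h.right, h.left, fun x hx y hy => by rw [lieForm_comm]; exact h.orth y hy x hx,
    h.sphere_right, h.sphere_left⟩

theorem IsContactElement.projection_mem_span {W : Submodule ℝ LieSpace} (hW : IsContactElement W)
    (hD : IsCompl D D') {x y z : LieSpace} (hxD : x ∈ D) (hyD : y ∈ D') (hx : x ∈ W) (hy : y ∈ W)
    (hx0 : x ≠ 0) (hy0 : y ≠ 0) (hz : z ∈ W) :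
    D.projection D' hD z ∈ Submodule.span ℝ {x} := by
  have hxy : y ∉ Submodule.span ℝ {x} := fun h => hy0 (Submodule.disjoint_def.1 hD.disjoint y
    ((Submodule.span_singleton_le_iff_mem x D).2 hxD h) hyD)
  obtain ⟨a, b, rfl⟩ := hW.exists_combination hx hy hx0 hxy hz
  rw [map_add, map_smul, map_smul, (Submodule.projection_eq_self_iff hD x).2 hxD,
    (Submodule.projection_apply_eq_zero_iff hD).2 hyD, smul_zero, add_zero]
  exact Submodule.smul_mem _ _ (Submodule.mem_span_singleton_self x)

theorem projection_add_projection (hD : IsCompl D D') (z : LieSpace) :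
    D.projection D' hD z + D'.projection D hD.symm z = z := by
  exact Submodule.projection_add_projection_eq_self hD z

theorem IsDupinSplitting.isCompl (h : IsDupinSplitting f D D' X Y U) : IsCompl D D' :=
  h.left.isCompl h.right h.orth

/-- The `D`-part of a transversal sphere is the curvature sphere lying in `D`. -/
theorem IsDupinSplitting.projection_ne_zero (h : IsDupinSplitting f D D' X Y U)
    (hf : IsLegendreMap f U) (hR : IsTransversalSphereCongruence R f U) (hY : Y ≠ 0) (hp : p ∈ U)
    {z : LieSpace} (hz : z ∈ R p) (hz0 : z ≠ 0) : D.projection D' h.isCompl z ≠ 0 := by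
  intro h0
  obtain ⟨x, hxD, hx⟩ := h.sphere_left p hp
  obtain ⟨y, hyD, hy⟩ := h.sphere_right p hp
  refine hR.notMem_span hp hY hy hz hz0 ?_
  have := (hf.contactElement p hp).projection_mem_span h.isCompl.symm hyD hxD hy.mem hx.mem hy.1
    hx.1 (hR.le p hp hz)
  rw [← projection_add_projection h.isCompl z, h0, zero_add]
  exact this

theorem IsDupinSplitting.projection_mem (h : IsDupinSplitting f D D' X Y U)
    (hf : IsLegendreMap f U) (hp : p ∈ U) {z : LieSpace} (hz : z ∈ f p) :
    D.projection D' h.isCompl z ∈ f p := by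
  obtain ⟨x, hxD, hx⟩ := h.sphere_left p hp
  obtain ⟨y, hyD, hy⟩ := h.sphere_right p hp
  exact (Submodule.span_singleton_le_iff_mem x (f p)).2 hx.mem
    ((hf.contactElement p hp).projection_mem_span h.isCompl hxD hyD hx.mem hy.mem hx.1 hy.1 hz)

theorem IsDupinSplitting.inf_eq_span (h : IsDupinSplitting f D D' X Y U)
    (hf : IsLegendreMap f U) (hp : p ∈ U) {z : LieSpace} (hz : z ∈ f p) (hzD : z ∈ D)
    (hz0 : z ≠ 0) : f p ⊓ D = Submodule.span ℝ {z} := by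
  obtain ⟨y, hyD, hy⟩ := h.sphere_right p hp
  refine le_antisymm (fun w hw => ?_) ((Submodule.span_singleton_le_iff_mem z _).2 ⟨hz, hzD⟩)
  have := (hf.contactElement p hp).projection_mem_span h.isCompl hzD hyD hz hy.mem hz0 hy.1 hw.1
  rwa [(Submodule.projection_eq_self_iff h.isCompl w).2 hw.2] at this

theorem contDiffOn_linearMap {N : Set (ℝ × ℝ)} {s : ℝ × ℝ → LieSpace} (hs : ContDiffOn ℝ ∞ s N)
    (L : LieSpace →ₗ[ℝ] LieSpace) : ContDiffOn ℝ ∞ (fun q => L (s q)) N :=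
  (LinearMap.toContinuousLinearMap L).contDiff.comp_contDiffOn hs

/-- The `D`-part of a lift of `R` represents the curvature sphere for `X`. Its `X`-derivative lies
in `f` by the curvature property and in `D` because `D` is fixed, hence in the line `f ⊓ D`. -/
theorem IsDupinSplitting.locallyConstantAlong (h : IsDupinSplitting f D D' X Y U)
    (hf : IsLegendreMap f U) (hU : IsOpen U) (hR : IsTransversalSphereCongruence R f U)
    (hY : Y ≠ 0) : LocallyConstantAlong (fun q => f q ⊓ D ⊔ D') X U := by
  intro p hp
  obtain ⟨N, hpN, hN, r, hr, hr0⟩ := hR.lift p hp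
  set s : ℝ × ℝ → LieSpace := fun q => D.projection D' h.isCompl (r q) with hs
  have hsD : ∀ q, s q ∈ D := fun q => Submodule.projection_apply_mem h.isCompl _
  have hsf : IsSectionOn f N s := ⟨hr.isOpen, contDiffOn_linearMap hr.smooth _, fun q hq =>
    h.projection_mem hf (hN hq) (hR.le q (hN hq) (hr.mem q hq))⟩
  have hs0 : ∀ q ∈ N, s q ≠ 0 := fun q hq =>
    h.projection_ne_zero hf hR hY (hN hq) (hr.mem q hq) (hr0 q hq)
  have hspan : ∀ q ∈ N, f q ⊓ D = Submodule.span ℝ {s q} := fun q hq =>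
    h.inf_eq_span hf (hN hq) (hsf.mem q hq) (hsD q) (hs0 q hq)
  have hsX : ∀ q ∈ N, dirDeriv X s q ∈ Submodule.span ℝ {s q} := by
    intro q hq
    rw [← hspan q hq]
    refine ⟨?_, dirDeriv_mem (hsf.differentiableAt hq) (Eventually.of_forall fun t => hsD _)⟩
    obtain ⟨x, hxD, hx⟩ := h.sphere_left q (hN hq)
    refine hf.dirDeriv_mem hU (hN hq) hsf hq (hx.of_mem_span ?_ (hs0 q hq))
    rw [← h.inf_eq_span hf (hN hq) hx.mem hxD hx.1]
    exact ⟨hsf.mem q hq, hsD q⟩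
  filter_upwards [eventually_span_eq hr.isOpen hpN (fun q hq => hsf.differentiableAt hq)
    (hs0 p hpN) hsX, (tendsto_line X p).eventually (hr.isOpen.eventually_mem hpN)] with t ht htN
  rw [hspan _ htN, hspan p hpN, ht]

/-- The right-hand side contains the lift `r` and does not change along `X`, so it also contains the
first two `X`-derivatives of `r`. -/
theorem IsDupinSplitting.osculatingSpace_le (h : IsDupinSplitting f D D' X Y U)
    (hf : IsLegendreMap f U) (hU : IsOpen U) (hR : IsTransversalSphereCongruence R f U)
    (hY : Y ≠ 0) (hp : p ∈ U) : osculatingSpace R X p ≤ f p ⊓ D ⊔ D' := by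
  obtain ⟨N, hpN, hN, r, hr, hr0⟩ := hR.lift p hp
  have hmem : ∀ q ∈ N, r q ∈ f q ⊓ D ⊔ D' := fun q hq => by
    rw [← projection_add_projection h.isCompl (r q)]
    exact Submodule.add_mem_sup ⟨h.projection_mem hf (hN hq) (hR.le q (hN hq) (hr.mem q hq)),
      Submodule.projection_apply_mem h.isCompl _⟩
      (Submodule.projection_apply_mem h.isCompl.symm _)
  have hev : ∀ᶠ t in 𝓝 (0 : ℝ), r (p + t • X) ∈ f p ⊓ D ⊔ D' := by
    filter_upwards [h.locallyConstantAlong hf hU hR hY p hp,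
      (tendsto_line X p).eventually (hr.isOpen.eventually_mem hpN)] with t ht htN
    rw [← ht]
    exact hmem _ htN
  rw [osculatingSpace_eq (fun q hq => hR.finrank_eq q (hN hq)) hr hr0 X hpN, Submodule.span_le]
  rintro w (rfl | rfl | rfl)
  · exact hmem p hpN
  · exact dirDeriv_mem (hr.differentiableAt hpN) hev
  · exact dirDeriv_dirDeriv_mem hr hpN hev

theorem IsDupinSplitting.finrank_le (h : IsDupinSplitting f D D' X Y U)
    (hf : IsLegendreMap f U) (hp : p ∈ U) :
    Module.finrank ℝ (f p ⊓ D ⊔ D' : Submodule ℝ LieSpace) ≤ 4 := by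
  obtain ⟨x, hxD, hx⟩ := h.sphere_left p hp
  have h1 := Submodule.finrank_add_le_finrank_add_finrank (f p ⊓ D) D'
  rw [h.right.finrank_eq, h.inf_eq_span hf hp hx.mem hxD hx.1, finrank_span_singleton hx.1] at h1
  rw [h.inf_eq_span hf hp hx.mem hxD hx.1]
  exact h1

/-- The osculating planes along `X` of the common sphere congruence of two Dupin cyclides are
constant along `X`. -/
theorem IsDupinSplitting.locallyConstantAlong_osculatingSpace {E E' : Submodule ℝ LieSpace}
    (hf : IsLegendreMap f U) (hg : IsLegendreMap g U) (hU : IsOpen U)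
    (hRf : IsTransversalSphereCongruence (ribaucourSphere f g) f U)
    (hRg : IsTransversalSphereCongruence (ribaucourSphere f g) g U) (hX : X ≠ 0) (hY : Y ≠ 0)
    (h : IsDupinSplitting f D D' X Y U) (h' : IsDupinSplitting g E E' X Y U) :
    LocallyConstantAlong (osculatingSpace (ribaucourSphere f g) X) X U := by
  have key : ∀ p ∈ U, osculatingSpace (ribaucourSphere f g) X p =
      (f p ⊓ D ⊔ D') ⊓ (g p ⊓ E ⊔ E') := by
    intro p hp
    have hle := le_inf (h.osculatingSpace_le hf hU hRf hY hp)
      (h'.osculatingSpace_le hg hU hRg hY hp)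
    by_contra hne
    -- An intersection larger than the osculating plane has dimension at least four, which forces
    -- the two spaces to coincide.
    have hlt := Submodule.finrank_lt_finrank_of_lt (lt_of_le_of_ne hle hne)
    rw [(hRf.isPlane21 hf hU hp hX).finrank_eq] at hlt
    have e1 := Submodule.eq_of_le_of_finrank_le
      (inf_le_left : (f p ⊓ D ⊔ D') ⊓ (g p ⊓ E ⊔ E') ≤ f p ⊓ D ⊔ D')
      ((h.finrank_le hf hp).trans hlt)
    have e2 := Submodule.eq_of_le_of_finrank_le
      (inf_le_right : (f p ⊓ D ⊔ D') ⊓ (g p ⊓ E ⊔ E') ≤ g p ⊓ E ⊔ E')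
      ((h'.finrank_le hg hp).trans hlt)
    have he : f p ⊓ D ⊔ D' = g p ⊓ E ⊔ E' := e1.symm.trans e2
    -- The curvature sphere `x` of `f` lies in the radical of the common space. Its `E'`-part then
    -- vanishes, so `x` lies in `g` and hence in the Ribaucour congruence, contradicting
    -- transversality.
    obtain ⟨x, hxD, hx⟩ := h.sphere_left p hp
    have hx' : x ∈ g p ⊓ E ⊔ E' := he ▸ Submodule.mem_sup_left ⟨hx.mem, hxD⟩
    have hxorth : ∀ y ∈ g p ⊓ E ⊔ E', lieForm x y = 0 := by
      rw [← he]
      intro y hy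
      obtain ⟨a, ha, d, hd, rfl⟩ := Submodule.mem_sup.1 hy
      rw [map_add, (hf.contactElement p hp).2 x hx.mem a ha.1, h.orth x hxD d hd, add_zero]
    obtain ⟨a, ha, d, hd, rfl⟩ := Submodule.mem_sup.1 hx'
    have hd0 : d = 0 := h'.right.eq_zero_of_orth hd fun y hy => by
      have := hxorth y (Submodule.mem_sup_right hy)
      rwa [map_add, LinearMap.add_apply, h'.orth a ha.2 y hy, zero_add] at this
    rw [hd0, add_zero] at hx
    exact hRf.transversal p hp X hX a ⟨hx.mem, ha.1⟩ hx
  intro p hp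
  filter_upwards [h.locallyConstantAlong hf hU hRf hY p hp,
    h'.locallyConstantAlong hg hU hRg hY p hp,
    (tendsto_line X p).eventually (hU.eventually_mem hp)] with t h1 h2 htU
  rw [key _ htU, key p hp, h1, h2]

/-- On a connected domain the two planes of a Dupin cyclide belong to fixed curvature
directions. -/
theorem IsDupinCyclide.exists_splitting (hf : IsLegendreMap f U) (hU : IsOpen U)
    (hUc : IsConnected U) (humb : IsUmbilicFree f U) (hR : IsTransversalSphereCongruence R f U)
    (hX : ∀ p ∈ U, IsCurvatureDirection f p X) (hY : ∀ p ∈ U, IsCurvatureDirection f p Y)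
    (hXY : ∀ Z : ℝ × ℝ, ∃ a b : ℝ, Z = a • X + b • Y) (h : IsDupinCyclide f U) :
    ∃ D D', IsDupinSplitting f D D' X Y U := by
  obtain ⟨D₁, D₂, hD₁, hD₂, horth, hsph⟩ := h
  have horth' : ∀ x ∈ D₂, ∀ y ∈ D₁, lieForm x y = 0 := fun x hx y hy => by
    rw [lieForm_comm]; exact horth y hy x hx
  have hcompl := hD₁.isCompl hD₂ horth
  -- The two possible assignments of planes to directions give disjoint sets covering `U`; once both
  -- are open, connectedness leaves only one.
  let A : Submodule ℝ LieSpace → Submodule ℝ LieSpace → Set (ℝ × ℝ) := fun D D' =>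
    {p | p ∈ U ∧ (∃ x ∈ D, IsCurvatureSphere f p X x) ∧ ∃ y ∈ D', IsCurvatureSphere f p Y y}
  have hcover : ∀ p ∈ U, p ∈ A D₁ D₂ ∨ p ∈ A D₂ D₁ := by
    intro p hp
    obtain ⟨⟨x, hxD, Z, hZ, hx⟩, y, hyD, Z', hZ', hy⟩ := hsph p hp
    obtain ⟨-, k, hk⟩ := hX p hp
    obtain ⟨-, l, hl⟩ := hY p hp
    have hnot : ∀ m, ¬ (x ∈ Submodule.span ℝ {m} ∧ y ∈ Submodule.span ℝ {m}) := by
      rintro m ⟨hxm, hym⟩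
      obtain ⟨a, rfl⟩ := Submodule.mem_span_singleton.1 hxm
      have ha : a ≠ 0 := fun ha => hx.1 (by rw [ha, zero_smul])
      have hm : m ∈ D₁ := (Submodule.smul_mem_iff D₁ ha).1 hxD
      exact hy.1 (Submodule.disjoint_def.1 hcompl.disjoint y
        ((Submodule.span_singleton_le_iff_mem m D₁).2 hm hym) hyD)
    rcases hf.curvatureSphere_dichotomy hU hp humb hXY hk hl hZ hx with hxk | hxl <;>
      rcases hf.curvatureSphere_dichotomy hU hp humb hXY hk hl hZ' hy with hyk | hyl
    · exact (hnot k ⟨hxk, hyk⟩).elim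
    · exact Or.inl ⟨hp, ⟨x, hxD, hk.of_mem_span hxk hx.1⟩, y, hyD, hl.of_mem_span hyl hy.1⟩
    · exact Or.inr ⟨hp, ⟨y, hyD, hk.of_mem_span hyk hy.1⟩, x, hxD, hl.of_mem_span hxl hx.1⟩
    · exact (hnot l ⟨hxl, hyl⟩).elim
  have hdisj : ∀ p, ¬ (p ∈ A D₁ D₂ ∧ p ∈ A D₂ D₁) := by
    rintro p ⟨⟨hp, ⟨x, hxD, hx⟩, -⟩, -, ⟨y, hyD, hy⟩, -⟩
    have := hf.curvatureSphere_unique hU hp (hX p hp).1 hx hy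
    exact hy.1 (Submodule.disjoint_def.1 hcompl.disjoint y
        ((Submodule.span_singleton_le_iff_mem x D₁).2 hxD this) hyD)
  -- Split `r = s + t` along `D ⊕ D'`. Where the `X`-sphere lies in `D`, `s_X` is in `f` and `⟨s_X,
  -- s_X⟩ = 0 < ⟨r_X, r_X⟩`; where it lies in `D'`, `t_X` is in `f` and the two norms agree. The
  -- strict inequality is an open condition that tells the cases apart.
  have hopen : ∀ D D' : Submodule ℝ LieSpace, IsCompl D D' →
      (∀ p ∈ U, p ∈ A D D' ∨ p ∈ A D' D) → IsOpen (A D D') := by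
    intro D D' hD hAA
    refine isOpen_iff_mem_nhds.2 fun p hpA => ?_
    have hp := hpA.1
    obtain ⟨N, hpN, hN, r, hr, hr0⟩ := hR.lift p hp
    have hrf := hR.section_left hN hr
    have hvec : ∀ q ∈ U, ∃ x ∈ D, ∃ y ∈ D', x ∈ f q ∧ y ∈ f q ∧ x ≠ 0 ∧ y ≠ 0 := by
      intro q hq
      rcases hAA q hq with ⟨-, ⟨x, hxD, hx⟩, y, hyD, hy⟩ | ⟨-, ⟨x, hxD, hx⟩, y, hyD, hy⟩
      · exact ⟨x, hxD, y, hyD, hx.mem, hy.mem, hx.1, hy.1⟩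
      · exact ⟨y, hyD, x, hxD, hy.mem, hx.mem, hy.1, hx.1⟩
    set s : ℝ × ℝ → LieSpace := fun q => D.projection D' hD (r q) with hs
    set t : ℝ × ℝ → LieSpace := fun q => D'.projection D hD.symm (r q) with ht
    have hst : r = s + t := funext fun q => (projection_add_projection hD (r q)).symm
    have hsf : IsSectionOn f N s := ⟨hr.isOpen, contDiffOn_linearMap hr.smooth _, fun q hq => by
      obtain ⟨x, hxD, y, hyD, hx, hy, hx0, hy0⟩ := hvec q (hN hq)
      exact (Submodule.span_singleton_le_iff_mem x (f q)).2 hx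
        ((hf.contactElement q (hN hq)).projection_mem_span hD hxD hyD hx hy hx0 hy0
          (hrf.mem q hq))⟩
    have htf : IsSectionOn f N t := ⟨hr.isOpen, contDiffOn_linearMap hr.smooth _, fun q hq => by
      obtain ⟨x, hxD, y, hyD, hx, hy, hx0, hy0⟩ := hvec q (hN hq)
      exact (Submodule.span_singleton_le_iff_mem y (f q)).2 hy
        ((hf.contactElement q (hN hq)).projection_mem_span hD.symm hyD hxD hy hx hy0 hx0
          (hrf.mem q hq))⟩
    -- a section whose value lies on a curvature sphere for `X` has its derivative in `f`
    have hcurv : ∀ q ∈ N, ∀ w, IsSectionOn f N w → ∀ x, IsCurvatureSphere f q X x →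
        w q ∈ Submodule.span ℝ {x} → dirDeriv X w q ∈ f q := by
      intro q hq w hw x hx hwx
      by_cases hw0 : w q = 0
      · exact hf.dirDeriv_mem_of_eq_zero hU (hN hq) hw hq hw0
      · exact hf.dirDeriv_mem hU (hN hq) hw hq (hx.of_mem_span hwx hw0)
    have hsX := contDiffOn_dirDeriv hr.isOpen hsf.smooth X
    have hrX := contDiffOn_dirDeriv hr.isOpen hr.smooth X
    have hc1 : ContinuousAt (fun q => lieForm (dirDeriv X s q) (dirDeriv X s q)) p :=
      (contDiffOn_lieForm hsX hsX).continuousOn.continuousAt (hr.isOpen.mem_nhds hpN)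
    have hc2 : ContinuousAt (fun q => lieForm (dirDeriv X r q) (dirDeriv X r q)) p :=
      (contDiffOn_lieForm hrX hrX).continuousOn.continuousAt (hr.isOpen.mem_nhds hpN)
    have hlt : lieForm (dirDeriv X s p) (dirDeriv X s p) <
        lieForm (dirDeriv X r p) (dirDeriv X r p) := by
      obtain ⟨-, ⟨x, hxD, hx⟩, y, hyD, hy⟩ := hpA
      have hmem := hcurv p hpN s hsf x hx ((hf.contactElement p hp).projection_mem_span hD hxD hyD
        hx.mem hy.mem hx.1 hy.1 (hrf.mem p hpN))
      rw [(hf.contactElement p hp).2 _ hmem _ hmem]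
      exact hf.pos_dirDeriv hp hrf hpN (hR.dirDeriv_notMem hN hr hr0 hpN (hX p hp).1)
    filter_upwards [hc1.eventually_lt hc2 hlt, hr.isOpen.mem_nhds hpN] with q hq hqN
    refine (hAA q (hN hqN)).resolve_right ?_
    rintro ⟨hqU, ⟨x, hxD, hx⟩, y, hyD, hy⟩
    have hmem := hcurv q hqN t htf x hx ((hf.contactElement q hqU).projection_mem_span hD.symm hxD
      hyD hx.mem hy.mem hx.1 hy.1 (hrf.mem q hqN))
    refine hq.ne ?_
    rw [hst, dirDeriv_add (hsf.differentiableAt hqN) (htf.differentiableAt hqN)]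
    have e1 := hf.orth_dirDeriv hqU hsf hqN X hmem
    have e2 := (hf.contactElement q hqU).2 _ hmem _ hmem
    simp [e1, e2, lieForm_comm (dirDeriv X t q) (dirDeriv X s q)]
  have := isPreconnected_iff_subset_of_disjoint.1 hUc.isPreconnected (A D₁ D₂) (A D₂ D₁)
    (hopen D₁ D₂ hcompl hcover) (hopen D₂ D₁ hcompl.symm fun p hp => (hcover p hp).symm)
    hcover (Set.eq_empty_of_forall_notMem fun p hp => hdisj p hp.2)
  rcases this with h | h
  · exact ⟨D₁, D₂, hD₁, hD₂, horth, fun p hp => (h hp).2.1, fun p hp => (h hp).2.2⟩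
  · exact ⟨D₂, D₁, hD₂, hD₁, horth', fun p hp => (h hp).2.1, fun p hp => (h hp).2.2⟩

end

/-! ### From constant osculating planes to Dupin cyclides -/

/-- The line spanned by the curvature sphere of `f` for the direction `X`. -/
def curvatureSphereSpace (f : ℝ × ℝ → Submodule ℝ LieSpace) (X p : ℝ × ℝ) :
    Submodule ℝ LieSpace :=
  Submodule.span ℝ {x | IsCurvatureSphere f p X x}

section

variable {f g R : ℝ × ℝ → Submodule ℝ LieSpace} {U N : Set (ℝ × ℝ)} {p q X Y : ℝ × ℝ}

theorem IsLegendreMap.curvatureSphereSpace_eq (hf : IsLegendreMap f U) (hU : IsOpen U)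
    (hp : p ∈ U) (hX : X ≠ 0) {x : LieSpace} (hx : IsCurvatureSphere f p X x) :
    curvatureSphereSpace f X p = Submodule.span ℝ {x} :=
  le_antisymm (Submodule.span_le.2 fun _ hy => hf.curvatureSphere_unique hU hp hX hx hy)
    (Submodule.span_mono (Set.singleton_subset_iff.2 hx))

/-- For a section `s` through `x`, the contact condition gives `⟨s, r⟩ = ⟨s, r_X⟩ = 0`;
differentiating once more, `⟨s, r_XX⟩ = -⟨s_X, r_X⟩`, which vanishes because `s_X` lies in `f`. -/
theorem IsTransversalSphereCongruence.orth_osculatingSpace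
    (hR : IsTransversalSphereCongruence R f U) (hf : IsLegendreMap f U)
    (hp : p ∈ U) {x : LieSpace} (hx : IsCurvatureSphere f p X x) :
    ∀ y ∈ osculatingSpace R X p, lieForm x y = 0 := by
  obtain ⟨N₁, hp₁, hN₁, r, hr, hr0⟩ := hR.lift p hp
  rw [osculatingSpace_eq (fun q hq => hR.finrank_eq q (hN₁ hq)) hr hr0 X hp₁]
  obtain ⟨-, N₂, hp₂, s, hs, rfl, hsX⟩ := hx
  have hpN : p ∈ N₁ ∩ N₂ := ⟨hp₁, hp₂⟩
  have hN : IsOpen (N₁ ∩ N₂) := hr.isOpen.inter hs.isOpen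
  replace hr : IsSectionOn f (N₁ ∩ N₂) r := (hR.section_left hN₁ hr).inter hs.isOpen
  replace hs : IsSectionOn f (N₁ ∩ N₂) s := hs.mono hN Set.inter_subset_right fun _ _ h => h
  have h2 := lieForm_dirDeriv_add_eq_zero (hs.differentiableAt hpN)
    (hr.differentiableAt_dirDeriv X hpN) (by
      filter_upwards [hN.mem_nhds hpN] with q hq
      exact hf.contact q (hN₁ hq.1) _ hq s r hs hr X) X
  rw [lieForm_comm (dirDeriv X s p), hf.orth_dirDeriv hp hr hpN X hsX, add_zero] at h2
  change Submodule.span ℝ _ ≤ LinearMap.ker (lieForm (s p))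
  rw [Submodule.span_le]
  rintro w (rfl | rfl | rfl)
  · exact (hf.contactElement p hp).2 _ (hs.mem p hpN) _ (hr.mem p hpN)
  · exact hf.contact p hp _ hpN s r hs hr X
  · exact h2

theorem mem_span_osculating {E : ℝ × ℝ → Submodule ℝ LieSpace} {s : ℝ × ℝ → LieSpace}
    (hs : IsSectionOn E N s) (hp : p ∈ N) {W : Submodule ℝ LieSpace} (hW : ∀ q ∈ N, s q ∈ W)
    (X : ℝ × ℝ) : Submodule.span ℝ {s p, dirDeriv X s p, dirDeriv X (dirDeriv X s) p} ≤ W := by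
  have hev : ∀ᶠ t in 𝓝 (0 : ℝ), s (p + t • X) ∈ W :=
    ((tendsto_line X p).eventually (hs.isOpen.eventually_mem hp)).mono fun _ h => hW _ h
  rw [Submodule.span_le]
  rintro w (rfl | rfl | rfl)
  · exact hW p hp
  · exact dirDeriv_mem (hs.differentiableAt hp) hev
  · exact dirDeriv_dirDeriv_mem hs hp hev

/-- If the osculating planes of `R` along `X` are constant along `X`, then so are the curvature
spheres for `X`. -/
theorem IsTransversalSphereCongruence.locallyConstantAlong_curvatureSphereSpace
    (hR : IsTransversalSphereCongruence R f U) (hf : IsLegendreMap f U) (hU : IsOpen U)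
    (hX : ∀ q ∈ U, IsCurvatureDirection f q X)
    (hC : LocallyConstantAlong (osculatingSpace R X) X U) :
    LocallyConstantAlong (curvatureSphereSpace f X) X U := by
  intro p hp
  have hX0 : X ≠ 0 := (hX p hp).1
  obtain ⟨N, hpN, hN, s, hs, hsc⟩ := hR.exists_curvatureSphere_section hf hU hX hp
  have hsX : ∀ q ∈ N, dirDeriv X s q ∈ Submodule.span ℝ {s q} := by
    intro q hq
    have hqU := hN hq
    set W := osculatingSpace R X q
    -- Near `q` on the `X`-line the osculating plane is still `W`, so `s` stays in the fixed space
    -- `W^⊥` and so does its derivative.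
    have horth : ∀ y ∈ W, lieForm (dirDeriv X s q) y = 0 := by
      intro y hy
      rw [lieForm_comm]
      refine dirDeriv_mem (W := LinearMap.ker (lieForm y)) (hs.differentiableAt hq) ?_
      filter_upwards [hC q hqU, (tendsto_line X q).eventually (hs.isOpen.eventually_mem hq)]
        with t ht htN
      rw [LinearMap.mem_ker, lieForm_comm]
      exact hR.orth_osculatingSpace hf (hN htN) (hsc _ htN) y (ht ▸ hy)
    obtain ⟨N', hqN', hN', r, hr, hr0⟩ := hR.lift q hqU
    have hrW : r q ∈ W := Submodule.subset_span ⟨N', hqN', r, hr, hr0, Or.inl rfl⟩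
    obtain ⟨a, b, hab⟩ := (hf.contactElement q hqU).exists_combination (hsc q hq).mem
      (hR.le q hqU (hr.mem q hqN')) (hsc q hq).1
      (hR.notMem_span hqU hX0 (hsc q hq) (hr.mem q hqN') (hr0 q hqN'))
      (hf.dirDeriv_mem hU hqU hs hq (hsc q hq))
    -- In `s_X = a s + b r`, both `s_X` and `s` are orthogonal to `W`, so `b r` lies in `W` and is
    -- orthogonal to it.
    have hb : b • r q = 0 := (hR.isPlane21 hf hU hqU hX0).eq_zero_of_orth (W.smul_mem b hrW)
      fun y hy => by
        have := horth y hy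
        rwa [← hab, map_add, LinearMap.add_apply, map_smul, LinearMap.smul_apply,
          hR.orth_osculatingSpace hf hqU (hsc q hq) y hy, smul_zero, zero_add] at this
    rw [← hab, hb, add_zero]
    exact Submodule.smul_mem _ _ (Submodule.mem_span_singleton_self _)
  filter_upwards [eventually_span_eq hs.isOpen hpN (fun q hq => hs.differentiableAt hq)
    (hsc p hpN).1 hsX, (tendsto_line X p).eventually (hs.isOpen.eventually_mem hpN)] with t ht htN
  rw [hf.curvatureSphereSpace_eq hU (hN htN) hX0 (hsc _ htN),
    hf.curvatureSphereSpace_eq hU hp hX0 (hsc p hpN), ht]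

theorem LocallyConstantAlong.mono {C : ℝ × ℝ → Submodule ℝ LieSpace} {V : Set (ℝ × ℝ)}
    (h : LocallyConstantAlong C X U) (hV : V ⊆ U) : LocallyConstantAlong C X V :=
  fun p hp => h p (hV hp)

/-- A curvature line parametrized Legendre map whose curvature spheres are constant along their
curvature lines is a Dupin cyclide. -/
theorem IsTransversalSphereCongruence.isDupinCyclide
    (hR : IsTransversalSphereCongruence R f U) (hf : IsLegendreMap f U) (hU : IsOpen U)
    (hUc : IsConnected U) (humb : IsUmbilicFree f U) (hcoord : IsCurvatureLineParametrized f U)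
    (hu : LocallyConstantAlong (curvatureSphereSpace f dirU) dirU U)
    (hv : LocallyConstantAlong (curvatureSphereSpace f dirV) dirV U) :
    IsDupinCyclide f U := by
  have hUV : ∀ Z : ℝ × ℝ, ∃ a b : ℝ, Z = a • dirU + b • dirV := fun Z => ⟨Z.1, Z.2, by simp⟩
  have hVU : ∀ Z : ℝ × ℝ, ∃ a b : ℝ, Z = a • dirV + b • dirU := fun Z => ⟨Z.2, Z.1, by simp⟩
  have hu0 : dirU ≠ 0 := by simp
  have hv0 : dirV ≠ 0 := by simp
  -- Each curvature sphere congruence is constant along its own direction, so its plane is osculated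
  -- along the other one.
  let D₁ := osculatingSpace (curvatureSphereSpace f dirU) dirV
  let D₂ := osculatingSpace (curvatureSphereSpace f dirV) dirU
  have hlocal : ∀ p ∈ U, ∃ B ∈ 𝓝 p, B ⊆ U ∧ ∀ q ∈ B, IsPlane21 (D₁ q) ∧ IsPlane21 (D₂ q) ∧
      (∀ x, IsCurvatureSphere f q dirU x → x ∈ D₁ q) ∧
      (∀ x, IsCurvatureSphere f q dirV x → x ∈ D₂ q) ∧
      ∀ q' ∈ B, ∀ x ∈ D₁ q, ∀ y ∈ D₂ q', lieForm x y = 0 := by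
    intro p hp
    obtain ⟨N₁, hp₁, hN₁, s, hs, hsc⟩ :=
      hR.exists_curvatureSphere_section hf hU (fun q hq => (hcoord q hq).1) hp
    obtain ⟨N₂, hp₂, hN₂, t, ht, htc⟩ :=
      hR.exists_curvatureSphere_section hf hU (fun q hq => (hcoord q hq).2) hp
    obtain ⟨ε, hε, hball⟩ := Metric.mem_nhds_iff.1
      ((hs.isOpen.inter ht.isOpen).mem_nhds ⟨hp₁, hp₂⟩)
    set B := Metric.ball p ε
    have hBU : B ⊆ U := fun q hq => hN₁ (hball hq).1
    replace hs : IsSectionOn f B s :=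
      hs.mono Metric.isOpen_ball (fun q hq => (hball hq).1) fun _ _ h => h
    replace ht : IsSectionOn f B t :=
      ht.mono Metric.isOpen_ball (fun q hq => (hball hq).2) fun _ _ h => h
    replace hsc : ∀ q ∈ B, IsCurvatureSphere f q dirU (s q) := fun q hq => hsc q (hball hq).1
    replace htc : ∀ q ∈ B, IsCurvatureSphere f q dirV (t q) := fun q hq => htc q (hball hq).2
    have hsK : IsSectionOn (curvatureSphereSpace f dirU) B s :=
      hs.mono hs.isOpen le_rfl fun q hq _ => Submodule.subset_span (hsc q hq)
    have htK : IsSectionOn (curvatureSphereSpace f dirV) B t :=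
      ht.mono ht.isOpen le_rfl fun q hq _ => Submodule.subset_span (htc q hq)
    have hKU : ∀ q ∈ B, curvatureSphereSpace f dirU q = Submodule.span ℝ {s q} := fun q hq =>
      hf.curvatureSphereSpace_eq hU (hBU hq) hu0 (hsc q hq)
    have hKV : ∀ q ∈ B, curvatureSphereSpace f dirV q = Submodule.span ℝ {t q} := fun q hq =>
      hf.curvatureSphereSpace_eq hU (hBU hq) hv0 (htc q hq)
    have hD₁ : ∀ q ∈ B, D₁ q =
        Submodule.span ℝ {s q, dirDeriv dirV s q, dirDeriv dirV (dirDeriv dirV s) q} :=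
      fun q hq => osculatingSpace_eq (fun q hq => by
        rw [hKU q hq, finrank_span_singleton (hsc q hq).1]) hsK (fun q hq => (hsc q hq).1) dirV hq
    have hD₂ : ∀ q ∈ B, D₂ q =
        Submodule.span ℝ {t q, dirDeriv dirU t q, dirDeriv dirU (dirDeriv dirU t) q} :=
      fun q hq => osculatingSpace_eq (fun q hq => by
        rw [hKV q hq, finrank_span_singleton (htc q hq).1]) htK (fun q hq => (htc q hq).1) dirU hq
    have hB : ∀ q : ℝ × ℝ, q ∈ B ↔ q.1 ∈ Metric.ball p.1 ε ∧ q.2 ∈ Metric.ball p.2 ε := by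
      intro q
      rw [← Set.mem_prod, ball_prod_same]
    -- Balls in `ℝ × ℝ` are squares, so the corner `(u', v)` is in `B`. Sliding `s` along `u` and
    -- `t` along `v` brings both spheres into the contact element `f (u', v)`.
    have hst : ∀ q ∈ B, ∀ q' ∈ B, lieForm (s q) (t q') = 0 := by
      rintro ⟨u, v⟩ hq ⟨u', v'⟩ hq'
      have hm : (u', v) ∈ B := (hB _).2 ⟨((hB _).1 hq').1, ((hB _).1 hq).2⟩
      have e1 : curvatureSphereSpace f dirU (u, v) = curvatureSphereSpace f dirU (u', v) := by
        simpa using (hu.mono hBU).eq_of_segment (0, v) (convex_ball p.1 ε).isPreconnected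
          (fun t ht => (hB _).2 (by simpa using ⟨ht, ((hB _).1 hq).2⟩)) ((hB _).1 hq).1
          ((hB _).1 hq').1
      have e2 : curvatureSphereSpace f dirV (u', v) = curvatureSphereSpace f dirV (u', v') := by
        simpa using (hv.mono hBU).eq_of_segment (u', 0) (convex_ball p.2 ε).isPreconnected
          (fun t ht => (hB _).2 (by simpa using ⟨((hB _).1 hq').1, ht⟩)) ((hB _).1 hq).2
          ((hB _).1 hq').2
      have m1 : s (u, v) ∈ f (u', v) := by
        have : s (u, v) ∈ Submodule.span ℝ {s (u', v)} := by
          rw [← hKU _ hm, ← e1, hKU _ hq]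
          exact Submodule.mem_span_singleton_self _
        exact (Submodule.span_singleton_le_iff_mem _ _).2 (hs.mem _ hm) this
      have m2 : t (u', v') ∈ f (u', v) := by
        have : t (u', v') ∈ Submodule.span ℝ {t (u', v)} := by
          rw [← hKV _ hm, e2, hKV _ hq']
          exact Submodule.mem_span_singleton_self _
        exact (Submodule.span_singleton_le_iff_mem _ _).2 (ht.mem _ hm) this
      exact (hf.contactElement _ (hBU hm)).2 _ m1 _ m2
    refine ⟨B, Metric.ball_mem_nhds p hε, hBU, fun q hq => ⟨?_, ?_, ?_, ?_, ?_⟩⟩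
    · rw [hD₁ q hq]
      refine hf.isPlane21_osculating hU (hBU hq) hs hq fun h => ?_
      exact hf.not_isCurvatureSphere hU (hBU hq) humb hUV (hsc q hq)
        ⟨(hsc q hq).1, B, hq, s, hs, rfl, h⟩
    · rw [hD₂ q hq]
      refine hf.isPlane21_osculating hU (hBU hq) ht hq fun h => ?_
      exact hf.not_isCurvatureSphere hU (hBU hq) humb hVU (htc q hq)
        ⟨(htc q hq).1, B, hq, t, ht, rfl, h⟩
    · intro x hx
      rw [hD₁ q hq]
      exact Submodule.span_mono (by simp)
        (hf.curvatureSphere_unique hU (hBU hq) hu0 (hsc q hq) hx)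
    · intro x hx
      rw [hD₂ q hq]
      exact Submodule.span_mono (by simp)
        (hf.curvatureSphere_unique hU (hBU hq) hv0 (htc q hq) hx)
    -- The orthogonality of all `s a` to all `t b` is differentiated in one variable at a time, with
    -- the other point held fixed.
    · intro q' hq' x hx y hy
      rw [hD₁ q hq] at hx
      rw [hD₂ q' hq'] at hy
      refine mem_span_osculating (W := LinearMap.ker (lieForm x)) ht hq' (fun b hb => ?_) dirU hy
      rw [LinearMap.mem_ker, lieForm_comm]
      refine mem_span_osculating (W := LinearMap.ker (lieForm (t b))) hs hq (fun a ha => ?_)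
        dirV hx
      rw [LinearMap.mem_ker, lieForm_comm]
      exact hst a ha b hb
  have hconst : ∀ p ∈ U, ∀ᶠ q in 𝓝[U] p, D₁ p = D₁ q ∧ D₂ p = D₂ q := by
    intro p hp
    obtain ⟨B, hB, hBU, h⟩ := hlocal p hp
    have hpB := mem_of_mem_nhds hB
    -- Orthogonality across different points gives `D₁ a ≤ (D₂ b)^⊥ = D₁ b`.
    have hle₁ : ∀ a ∈ B, ∀ b ∈ B, D₁ a ≤ D₁ b := fun a ha b hb z hz =>
      (h b hb).1.mem_of_orth (h b hb).2.1 ((h b hb).2.2.2.2 b hb) ((h a ha).2.2.2.2 b hb z hz)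
    have hle₂ : ∀ a ∈ B, ∀ b ∈ B, D₂ a ≤ D₂ b := fun a ha b hb z hz =>
      (h b hb).2.1.mem_of_orth (h b hb).1
        (fun x hx y hy => by rw [lieForm_comm]; exact (h b hb).2.2.2.2 b hb y hy x hx)
        (fun y hy => by rw [lieForm_comm]; exact (h b hb).2.2.2.2 a ha y hy z hz)
    filter_upwards [mem_nhdsWithin_of_mem_nhds hB] with q hq
    exact ⟨le_antisymm (hle₁ p hpB q hq) (hle₁ q hq p hpB),
      le_antisymm (hle₂ p hpB q hq) (hle₂ q hq p hpB)⟩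
  obtain ⟨p₀, hp₀⟩ := hUc.nonempty
  have hall : ∀ q ∈ U, D₁ p₀ = D₁ q ∧ D₂ p₀ = D₂ q := fun q hq =>
    hUc.isPreconnected.induction₂ (fun a b => D₁ a = D₁ b ∧ D₂ a = D₂ b) hconst
      (fun _ _ _ _ _ _ h h' => ⟨h.1.trans h'.1, h.2.trans h'.2⟩)
      (fun _ _ _ _ h => ⟨h.1.symm, h.2.symm⟩) hp₀ hq
  obtain ⟨B₀, hB₀, -, h₀⟩ := hlocal p₀ hp₀
  have h₀ := h₀ p₀ (mem_of_mem_nhds hB₀)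
  refine ⟨D₁ p₀, D₂ p₀, h₀.1, h₀.2.1, h₀.2.2.2.2 p₀ (mem_of_mem_nhds hB₀), fun p hp => ?_⟩
  obtain ⟨B, hB, -, h⟩ := hlocal p hp
  have h := h p (mem_of_mem_nhds hB)
  obtain ⟨⟨-, x, hx⟩, -, y, hy⟩ := hcoord p hp
  rw [(hall p hp).1, (hall p hp).2]
  exact ⟨⟨x, h.2.2.1 x hx, dirU, hu0, hx⟩, y, h.2.2.2.1 y hy, dirV, hv0, hy⟩

end

/-! ### The theorem on Ribaucour cyclides -/

theorem mainTheorem6 (U : Set (ℝ × ℝ)) (hU : IsOpen U) (hUc : IsConnected U)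
    (f g : ℝ × ℝ → Submodule ℝ LieSpace)
    (hfg : IsRibaucourPair f g U)
    (hf : IsUmbilicFree f U) (hg : IsUmbilicFree g U)
    (hcoord : IsCurvatureLineParametrized f U)
    (hr : ∀ p ∈ U, ∀ X, X ≠ 0 → ∀ x ∈ ribaucourSphere f g p, ¬ IsCurvatureSphere f p X x) :
    (∀ p ∈ U, IsPlane21 (ribaucourCyclide₁ f g p) ∧ IsPlane21 (ribaucourCyclide₂ f g p)) ∧
    ((IsDupinCyclide f U ∧ IsDupinCyclide g U) ↔
      (IsConstantAlongV (ribaucourCyclide₁ f g) U ∧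
        IsConstantAlongU (ribaucourCyclide₂ f g) U)) := by
  have hRf := hfg.isTransversalSphereCongruence_left hU hr
  have hRg := hfg.isTransversalSphereCongruence_right hU hr
  have hcoord' : IsCurvatureLineParametrized g U := fun p hp =>
    ⟨(hfg.curvature p hp _).1 (hcoord p hp).1, (hfg.curvature p hp _).1 (hcoord p hp).2⟩
  have hu0 : dirU ≠ 0 := by simp
  have hv0 : dirV ≠ 0 := by simp
  have hUV : ∀ Z : ℝ × ℝ, ∃ a b : ℝ, Z = a • dirU + b • dirV := fun Z => ⟨Z.1, Z.2, by simp⟩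
  rw [isConstantAlongU_iff hU, isConstantAlongV_iff hU]
  refine ⟨fun p hp => ⟨hRf.isPlane21 hfg.left hU hp hv0, hRf.isPlane21 hfg.left hU hp hu0⟩, ?_, ?_⟩
  · rintro ⟨hDf, hDg⟩
    obtain ⟨D, D', hD⟩ := hDf.exists_splitting hfg.left hU hUc hf hRf
      (fun p hp => (hcoord p hp).1) (fun p hp => (hcoord p hp).2) hUV
    obtain ⟨E, E', hE⟩ := hDg.exists_splitting hfg.right hU hUc hg hRg
      (fun p hp => (hcoord' p hp).1) (fun p hp => (hcoord' p hp).2) hUV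
    exact ⟨IsDupinSplitting.locallyConstantAlong_osculatingSpace hfg.left hfg.right hU hRf hRg
      hv0 hu0 hD.swap hE.swap, IsDupinSplitting.locallyConstantAlong_osculatingSpace hfg.left
      hfg.right hU hRf hRg hu0 hv0 hD hE⟩
  · rintro ⟨hv, hu⟩
    exact ⟨hRf.isDupinCyclide hfg.left hU hUc hf hcoord
        (hRf.locallyConstantAlong_curvatureSphereSpace hfg.left hU
          (fun p hp => (hcoord p hp).1) hu)
        (hRf.locallyConstantAlong_curvatureSphereSpace hfg.left hU
          (fun p hp => (hcoord p hp).2) hv),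
      hRg.isDupinCyclide hfg.right hU hUc hg hcoord'
        (hRg.locallyConstantAlong_curvatureSphereSpace hfg.right hU
          (fun p hp => (hcoord' p hp).1) hu)
        (hRg.locallyConstantAlong_curvatureSphereSpace hfg.right hU
          (fun p hp => (hcoord' p hp).2) hv)⟩
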